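/- All graphs are finite, undirected and simple. Let $M$ be a matching of a graph $G$; a vertex is saturated by $M$ if it lies on an edge of $M$. A path is $M$-alternating if, of any two consecutive edges, exactly one belongs to $M$; an $mm$-$M$-path is an $M$-alternating path with at least one edge whose first and last edges belong to $M$. An $M$-blossom is an odd cycle of length $2k+1$ with exactly $k$ edges in $M$; its base is the vertex of the cycle incident with none of these $k$ edges. An $M$-flower is an $M$-blossom together with an $M$-alternating path of even (possibly zero) length from its base to a vertex not saturated by $M$, such that the base is the only common vertex of the path and the blossom. An $M$-posy consists of two $M$-blossoms and an $mm$-$M$-path joining their bases, such that no internal vertex of the path lies in the blossoms and the intersection of the two blossoms (as subgraphs) is either empty or an $mm$-$M$-path. Let $SD(G)$ be the set of vertices $v$ of $G$ such that, for some maximum (that is, maximum-cardinality) matching $M$ of $G$, $v$ lies in an $M$-flower or an $M$-posy, and let $KE(G)=V(G)\setminus SD(G)$. The graph $G$ is a Sterboul–Deming graph if $KE(G)=\emptyset$. For $S\subseteq V(G)$, let $N(S)$ be the set of vertices having a neighbor in $S$, and let $\mathrm{odd}(G-S)$ be the number of connected components of $G-S$ with an odd number of vertices. **Theorem.** A graph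 $G$ is a Sterboul–Deming graph with a perfect matching if and only if 1. $|N(S)|>|S|$ for every non-empty independent set $S\subseteq V(G)$, and 2. $\mathrm{odd}(G-S)\le |S|$ for every $S\subseteq V(G)$. -/

import Mathlib

namespace SterboulDeming

variable {V : Type*} {G : SimpleGraph V}

/-- `M` is a matching of maximum cardinality. The vertices saturated by `M` are those in `M.verts`. -/
def IsMaximumMatching (M : G.Subgraph) : Prop :=
  M.IsMatching ∧ ∀ M' : G.Subgraph, M'.IsMatching → M'.edgeSet.ncard ≤ M.edgeSet.ncard

/-- Of any two consecutive edges of the walk `p`, exactly one belongs to `M`. -/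
def IsAlternating (M : G.Subgraph) {u v : V} (p : G.Walk u v) : Prop :=
  p.edges.IsChain fun e f => Xor (e ∈ M.edgeSet) (f ∈ M.edgeSet)

/-- `p` is an alternating path whose first and last edges exist and belong to `M`. -/
def IsMMPath (M : G.Subgraph) {u v : V} (p : G.Walk u v) : Prop :=
  p.IsPath ∧ IsAlternating M p ∧
    (∃ e ∈ p.edges.head?, e ∈ M.edgeSet) ∧ (∃ e ∈ p.edges.getLast?, e ∈ M.edgeSet)

/-- The cycle `c`, written from `b` to `b`, is a blossom with base `b`: its length is `2 * k + 1`,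
exactly `k` of its edges are in `M`, and no edge of `c` at `b` is in `M`. -/
def IsBlossom (M : G.Subgraph) {b : V} (c : G.Walk b b) : Prop :=
  c.IsCycle ∧
    (∃ k : ℕ, c.length = 2 * k + 1 ∧ {e | e ∈ c.edges ∧ e ∈ M.edgeSet}.ncard = k) ∧
    ∀ e ∈ c.edges, b ∈ e → e ∉ M.edgeSet

/-- A flower: the blossom `c` with base `b`, together with the stem `p`, an alternating path of
even (possibly zero) length from `b` to an unsaturated vertex `r`, that meets `c` only in `b`. -/
def IsTFlower (M : G.Subgraph) {b r : V} (c : G.Walk b b) (p : G.Walk b r) : Prop :=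
  IsBlossom M c ∧ p.IsPath ∧ IsAlternating M p ∧ Even p.length ∧ r ∉ M.verts ∧
    ∀ x, x ∈ c.support → x ∈ p.support → x = b

/-- A posy: two blossoms whose bases are joined by an `mm`-path `p` with no internal vertex in
either blossom; the two blossoms are disjoint (subdivided barbell) or their intersection is an
`mm`-path (subdivided complete graph on four vertices). -/
def IsTPosy (M : G.Subgraph) {b₁ b₂ : V}
    (c₁ : G.Walk b₁ b₁) (p : G.Walk b₁ b₂) (c₂ : G.Walk b₂ b₂) : Prop :=
  IsBlossom M c₁ ∧ IsBlossom M c₂ ∧ IsMMPath M p ∧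
    (∀ x ∈ p.support, x ≠ b₁ → x ≠ b₂ → x ∉ c₁.support ∧ x ∉ c₂.support) ∧
    ((∀ x ∈ c₁.support, x ∉ c₂.support) ∨
      ∃ (s t : V) (q : G.Walk s t), IsMMPath M q ∧ c₁.toSubgraph ⊓ c₂.toSubgraph = q.toSubgraph)

/-- `v` is a vertex of some flower relative to `M`. -/
def LiesInTFlower (M : G.Subgraph) (v : V) : Prop :=
  ∃ (b r : V) (c : G.Walk b b) (p : G.Walk b r),
    IsTFlower M c p ∧ (v ∈ c.support ∨ v ∈ p.support)

/-- `v` is a vertex of some posy relative to `M`. -/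
def LiesInTPosy (M : G.Subgraph) (v : V) : Prop :=
  ∃ (b₁ b₂ : V) (c₁ : G.Walk b₁ b₁) (p : G.Walk b₁ b₂) (c₂ : G.Walk b₂ b₂),
    IsTPosy M c₁ p c₂ ∧ (v ∈ c₁.support ∨ v ∈ p.support ∨ v ∈ c₂.support)

/-- `SD(G)`: the vertices lying in a flower or a posy relative to some maximum matching. -/
def SD (G : SimpleGraph V) : Set V :=
  {v | ∃ M : G.Subgraph, IsMaximumMatching M ∧ (LiesInTPosy M v ∨ LiesInTFlower M v)}

/-- `KE(G) = V(G) - SD(G)`. -/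
def KE (G : SimpleGraph V) : Set V := (SD G)ᶜ

/-- `G` is a Sterboul–Deming graph. -/
def IsSterboulDemingGraph (G : SimpleGraph V) : Prop := KE G = ∅

/-- `N(S)`: the set of vertices that have a neighbor in `S`. -/
def neighbors (G : SimpleGraph V) (S : Set V) : Set V := ⋃ v ∈ S, G.neighborSet v

/-- `odd(G - S)`: the number of connected components of odd order of `G - S`. -/
noncomputable def numOddComponents (G : SimpleGraph V) (S : Set V) : ℕ :=
  ((⊤ : G.Subgraph).deleteVerts S).coe.oddComponents.ncard

end SterboulDeming

/-! Tutte's theorem turns condition 2 into the existence of a perfect matching, encoded here by an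
involution `σ` sending each vertex to a neighbour. All maximum matchings are then perfect, so there
are no flowers, and the claim becomes: every vertex lies in a posy iff no non-empty independent `S`
has |N(S)| ≤ |S|. For independent `S` this inequality means σ(N(S)) ⊆ S (`isTight_iff`); such sets
are called tight, and they do not depend on the matching.

Membership in a tight set propagates along alternating paths, two steps at a time. A base in `S`
would force its partner into `S`, against independence, and any other vertex of a posy in `S` would
force a base into `S`. Hence posies avoid tight sets (`IsTight.not_mem_posy`).

Conversely, let `v` be good in `H`: no tight set contains `v` or its partner. Posies survive the
addition of edges, so `H` may be taken minimal with this property (`Good.hasPosy`). Start with the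
matching edge at `v` as a two-coloured frame. The vertices reached by alternating walks from one
colour class would form a tight set unless some walk comes back to the frame; a shortest one yields
an ear or a lollipop attached at that colour (`Frame.exists_att`). Disjoint attachments of both
colours complete the frame to a posy (`Frame.hasPosy_of_disjoint`). If they meet, splicing them
gives a posy or an alternating path between roots of different colours (`Frame.exists_link`). For a
single-edge frame this path closes an even alternating cycle, which becomes the new frame. For a
longer frame, either a posy appears or some frame edge can be deleted with `v` remaining good
(`Frame.cut`), against minimality. -/

namespace SterboulDeming

/-- The involution `σ` pairs every vertex with a neighbour: it encodes a perfect matching. -/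
def IsPairing {V : Type*} (H : SimpleGraph V) (σ : V → V) : Prop :=
  (∀ x, σ (σ x) = x) ∧ ∀ x, H.Adj x (σ x)

/-- The list `l` has the form `x₁, σ x₁, x₂, σ x₂, …`. -/
inductive Paired {V : Type*} (σ : V → V) : List V → Prop
  | nil : Paired σ []
  | cons (x : V) {l : List V} : Paired σ l → Paired σ (x :: σ x :: l)

/-- `l` lists the interior vertices of a walk from `x` to `y`. -/
def Pth {V : Type*} (R : V → V → Prop) (x : V) (l : List V) (y : V) : Prop :=
  (x :: l ++ [y]).IsChain R

/-! ### Alternating paths as lists of matched pairs -/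

section Lists

variable {V : Type*} {H : SimpleGraph V} {σ τ : V → V} {R : V → V → Prop}

theorem Paired.append {l m : List V} (hl : Paired σ l) (hm : Paired σ m) : Paired σ (l ++ m) := by
  induction hl with
  | nil => exact hm
  | cons x _ ih => exact .cons x ih

theorem Paired.reverse (hσ : ∀ x, σ (σ x) = x) {l : List V} (hl : Paired σ l) :
    Paired σ l.reverse := by
  induction hl with
  | nil => exact .nil
  | cons x _ ih =>
    have : Paired σ [σ x, x] := by
      have := Paired.cons (σ := σ) (σ x) .nil
      rwa [hσ] at this
    simpa using ih.append this

theorem Paired.even {l : List V} (hl : Paired σ l) : Even l.length := by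
  induction hl with
  | nil => simp
  | cons x _ ih => simpa [Nat.even_add_one] using ih

theorem Paired.mem (hσ : ∀ x, σ (σ x) = x) {l : List V} (hl : Paired σ l) {x : V} (hx : x ∈ l) :
    σ x ∈ l := by
  induction hl with
  | nil => simp at hx
  | cons y _ ih =>
    simp only [List.mem_cons] at hx ⊢
    rcases hx with rfl | rfl | hx
    · simp
    · simp [hσ]
    · exact .inr (.inr (ih hx))

theorem Paired.of_append {l m : List V} (h : Paired σ (l ++ m)) (hl : Even l.length) :
    Paired σ l ∧ Paired σ m := by
  induction l using List.twoStepInduction with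
  | nil => exact ⟨.nil, h⟩
  | singleton x => simp at hl
  | cons_cons x y l ih _ =>
    cases h with
    | cons _ h =>
      have := ih h (by simpa [Nat.even_add_one] using hl)
      exact ⟨.cons _ this.1, this.2⟩

theorem Paired.congr {l : List V} (hl : Paired σ l) (h : ∀ x ∈ l, τ x = σ x) : Paired τ l := by
  induction hl with
  | nil => exact .nil
  | @cons x l _ ih =>
    have := Paired.cons (σ := τ) x (ih fun y hy => h y (by simp [hy]))
    rwa [h x (by simp)] at this

theorem Paired.split {l : List V} (hl : Paired σ l) {x : V} (hx : x ∈ l) :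
    ∃ l₁ y l₂, l = l₁ ++ [y, σ y] ++ l₂ ∧ Paired σ l₁ ∧ Paired σ l₂ ∧ (x = y ∨ x = σ y) := by
  induction hl with
  | nil => simp at hx
  | @cons y l hl ih =>
    simp only [List.mem_cons] at hx
    rcases hx with rfl | rfl | hx
    · exact ⟨[], x, l, by simp, .nil, hl, .inl rfl⟩
    · exact ⟨[], y, l, by simp, .nil, hl, .inr rfl⟩
    · obtain ⟨l₁, z, l₂, rfl, h₁, h₂, h⟩ := ih hx
      exact ⟨y :: σ y :: l₁, z, l₂, by simp, .cons y h₁, h₂, h⟩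

/-- The first pair of a paired list that meets a given set. -/
theorem Paired.first {l : List V} (hl : Paired σ l) (p : V → Prop)
    (hp' : ∀ x, p (σ x) → p x) :
    (∀ x ∈ l, ¬ p x) ∨ ∃ l₁ y l₂, l = l₁ ++ [y, σ y] ++ l₂ ∧ Paired σ l₁ ∧ Paired σ l₂ ∧
      p y ∧ ∀ x ∈ l₁, ¬ p x := by
  induction hl with
  | nil => simp
  | @cons y l hl ih =>
    by_cases hy : p y
    · exact .inr ⟨[], y, l, by simp, .nil, hl, hy, by simp⟩
    · have hy' : ¬ p (σ y) := fun h => hy (hp' _ h)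
      rcases ih with ih | ⟨l₁, z, l₂, rfl, h₁, h₂, h, h'⟩
      · left; simpa [hy, hy'] using ih
      · exact .inr ⟨y :: σ y :: l₁, z, l₂, by simp, .cons y h₁, h₂, h,
          by simpa [hy, hy'] using h'⟩

theorem Pth.reverse (hR : ∀ x y, R x y → R y x) {x y : V} {l : List V} (h : Pth R x l y) :
    Pth R y l.reverse x := by
  unfold Pth at *
  have : (y :: l.reverse ++ [x]) = (x :: l ++ [y]).reverse := by simp
  rw [this, List.isChain_reverse]
  exact h.imp fun a b hab => hR _ _ hab

theorem pth_append_cons {x y z : V} {l m : List V} :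
    Pth R x (l ++ z :: m) y ↔ Pth R x l z ∧ Pth R z m y := by
  unfold Pth
  simpa using List.isChain_cons_split (R := R) (a := x) (c := z) (l₁ := l) (l₂ := m ++ [y])

theorem pth_nil {x y : V} : Pth R x [] y ↔ R x y := by simp [Pth]

theorem pth_cons {x y z : V} {m : List V} : Pth R x (z :: m) y ↔ R x z ∧ Pth R z m y := by
  simpa [pth_nil] using pth_append_cons (R := R) (x := x) (l := []) (z := z) (m := m) (y := y)

theorem Pth.mono {S : V → V → Prop} (h : ∀ x y, R x y → S x y) {x y : V} {l : List V}
    (hl : Pth R x l y) : Pth S x l y := List.IsChain.imp (fun a b hab => h a b hab) hl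

theorem Pth.left {x y : V} {l : List V} (h : Pth R x l y) : (x :: l).IsChain R :=
  List.IsChain.left_of_append h

theorem Pth.inner {x y : V} {l : List V} (h : Pth R x l y) : l.IsChain R :=
  (List.isChain_cons.1 h.left).2

theorem isChain_reverse_of_symm (hR : ∀ x y, R x y → R y x) {l : List V} (h : l.IsChain R) :
    l.reverse.IsChain R :=
  List.isChain_reverse.2 (h.imp fun _ _ hab => hR _ _ hab)

/-- Along a properly coloured walk the parity of the length is read off at the ends. -/
theorem Pth.even_iff {χ : V → Bool} {x y : V} {l : List V} (h : Pth R x l y)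
    (hR : ∀ a b, R a b → χ a ≠ χ b) : Even l.length ↔ χ x ≠ χ y := by
  induction l generalizing x with
  | nil => simpa using hR _ _ (pth_nil.1 h)
  | cons z l ih =>
    have h' := pth_cons.1 h
    have h1 := hR _ _ h'.1
    have := ih h'.2
    rw [List.length_cons, Nat.even_add_one, this]
    revert h1
    cases χ x <;> cases χ y <;> cases χ z <;> simp

/-- Consecutive entries of `l` are adjacent, in pairs. -/
inductive PairAdj (H : SimpleGraph V) : List V → Prop
  | nil : PairAdj H []
  | cons {x y : V} {l : List V} : H.Adj x y → PairAdj H l → PairAdj H (x :: y :: l)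

theorem PairAdj.append {l m : List V} (hl : PairAdj H l) (hm : PairAdj H m) :
    PairAdj H (l ++ m) := by
  induction hl with
  | nil => exact hm
  | cons h _ ih => exact .cons h ih

theorem PairAdj.of_chain {l : List V} (h : l.IsChain H.Adj) (hl : Even l.length) :
    PairAdj H l := by
  induction l using List.twoStepInduction with
  | nil => exact .nil
  | singleton x => simp at hl
  | cons_cons x y l ih _ =>
    rw [List.isChain_cons_cons] at h
    exact .cons h.1 (ih (List.isChain_cons.1 h.2).2 (by simpa [Nat.even_add_one] using hl))

theorem PairAdj.exists_pairing {l : List V} (h : PairAdj H l) (hn : l.Nodup) :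
    ∃ τ : V → V, Paired τ l ∧ ∀ x ∈ l, τ x ∈ l ∧ τ (τ x) = x ∧ H.Adj x (τ x) := by
  classical
  induction h with
  | nil => exact ⟨id, .nil, by simp⟩
  | @cons x y l hxy hl ih =>
    simp only [List.nodup_cons, List.mem_cons, not_or] at hn
    obtain ⟨τ, hτ, h⟩ := ih hn.2.2
    refine ⟨fun z => if z = x then y else if z = y then x else τ z, ?_, ?_⟩
    · have h1 : Paired (fun z => if z = x then y else if z = y then x else τ z) l := by
        refine hτ.congr fun z hz => ?_
        have : z ≠ x := by rintro rfl; exact hn.1.2 hz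
        have : z ≠ y := by rintro rfl; exact hn.2.1 hz
        simp [*]
      simpa using Paired.cons x h1
    · intro z hz
      simp only [List.mem_cons] at hz
      have hyx : y ≠ x := fun h => hn.1.1 h.symm
      rcases hz with rfl | rfl | hz
      · simp [hyx, hxy]
      · simp [hyx, hxy.symm]
      · have h1 : z ≠ x := by rintro rfl; exact hn.1.2 hz
        have h2 : z ≠ y := by rintro rfl; exact hn.2.1 hz
        obtain ⟨h3, h4, h5⟩ := h z hz
        have h6 : τ z ≠ x := by intro h; rw [h] at h3; exact hn.1.2 h3
        have h7 : τ z ≠ y := by intro h; rw [h] at h3; exact hn.2.1 h3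
        simp [*]

/-- A pairing can be changed to a prescribed one on an invariant list. -/
theorem exists_repair {l : List V} (hσ : ∀ x, σ (σ x) = x) (hinv : ∀ x ∈ l, σ x ∈ l)
    (hadj : ∀ x ∉ l, H.Adj x (σ x)) (h : PairAdj H l) (hn : l.Nodup) :
    ∃ τ, IsPairing H τ ∧ Paired τ l ∧ ∀ x ∉ l, τ x = σ x := by
  classical
  obtain ⟨τ, hτ, h⟩ := h.exists_pairing hn
  have hinv' : ∀ x ∉ l, σ x ∉ l := fun x hx h => hx (by simpa [hσ] using hinv _ h)
  refine ⟨fun z => if z ∈ l then τ z else σ z, ⟨fun x => ?_, fun x => ?_⟩,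
    hτ.congr fun x hx => by simp [hx], fun x hx => by simp [hx]⟩
  · by_cases hx : x ∈ l
    · simp [hx, (h x hx).1, (h x hx).2.1]
    · simp [hx, hinv' x hx, hσ]
  · by_cases hx : x ∈ l
    · simpa [hx] using (h x hx).2.2
    · simpa [hx] using hadj x hx

end Lists

/-! ### Posies in list form -/

/-- List form of a posy through `v`. The path joining the bases is `P`; the blossoms run through
`A₁ ++ Q ++ B₁` and `A₂ ++ Q ++ B₂`, so `Q` is their intersection. -/
structure PosyData {V : Type*} (H : SimpleGraph V) (σ : V → V) (P A₁ B₁ A₂ B₂ Q : List V)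
    (b₁ b₂ : V) : Prop where
  pairing : IsPairing H σ
  paired : Paired σ P ∧ Paired σ A₁ ∧ Paired σ B₁ ∧ Paired σ A₂ ∧ Paired σ B₂ ∧ Paired σ Q
  nodup : (P ++ A₁ ++ B₁ ++ A₂ ++ B₂ ++ Q).Nodup
  chain : P.IsChain H.Adj
  head : P.head? = some b₁
  last : P.getLast? = some b₂
  blossom₁ : Pth H.Adj b₁ (A₁ ++ Q ++ B₁) b₁
  blossom₂ : Pth H.Adj b₂ (A₂ ++ Q ++ B₂) b₂

/-- Some perfect matching of `H` has a posy through `v`. -/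
def HasPosy {V : Type*} (H : SimpleGraph V) (v : V) : Prop :=
  ∃ σ P A₁ B₁ A₂ B₂ Q b₁ b₂, PosyData H σ P A₁ B₁ A₂ B₂ Q b₁ b₂ ∧
    v ∈ P ++ A₁ ++ B₁ ++ A₂ ++ B₂ ++ Q

theorem HasPosy.mono {V : Type*} {H G : SimpleGraph V} (h : H ≤ G) {v : V} (hv : HasPosy H v) :
    HasPosy G v := by
  obtain ⟨σ, P, A₁, B₁, A₂, B₂, Q, b₁, b₂, hp, hv⟩ := hv
  exact ⟨σ, P, A₁, B₁, A₂, B₂, Q, b₁, b₂, ⟨⟨hp.pairing.1, fun x => h (hp.pairing.2 x)⟩,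
    hp.paired, hp.nodup, hp.chain.imp fun _ _ hab => h hab, hp.head, hp.last,
    hp.blossom₁.mono fun _ _ hab => h hab, hp.blossom₂.mono fun _ _ hab => h hab⟩, hv⟩

/-- Posies may be given without naming the matching: all pieces have even order, and the set they
cover together with the leftover piece `X` is invariant under some perfect matching. -/
theorem hasPosy_of_lists {V : Type*} {H : SimpleGraph V} {σ : V → V} (hσ : IsPairing H σ)
    {P A₁ B₁ A₂ B₂ Q X N : List V} {b₁ b₂ v : V}
    (hperm : (P ++ A₁ ++ B₁ ++ A₂ ++ B₂ ++ Q ++ X).Perm N) (hN : N.Nodup)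
    (hinv : ∀ x ∈ N, σ x ∈ N)
    (heven : Even P.length ∧ Even A₁.length ∧ Even B₁.length ∧ Even A₂.length ∧ Even B₂.length ∧
      Even Q.length ∧ Even X.length)
    (hP : P.IsChain H.Adj) (hhead : P.head? = some b₁) (hlast : P.getLast? = some b₂)
    (h₁ : Pth H.Adj b₁ (A₁ ++ Q ++ B₁) b₁) (h₂ : Pth H.Adj b₂ (A₂ ++ Q ++ B₂) b₂)
    (hX : X.IsChain H.Adj) (hv : v ∈ P ++ A₁ ++ B₁ ++ A₂ ++ B₂ ++ Q) : HasPosy H v := by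
  obtain ⟨e1, e2, e3, e4, e5, e6, e7⟩ := heven
  have i1 := h₁.inner
  have i2 := h₂.inner
  have cA₁ : A₁.IsChain H.Adj := i1.left_of_append.left_of_append
  have cQ : Q.IsChain H.Adj := i1.left_of_append.right_of_append
  have cB₁ : B₁.IsChain H.Adj := i1.right_of_append
  have cA₂ : A₂.IsChain H.Adj := i2.left_of_append.left_of_append
  have cB₂ : B₂.IsChain H.Adj := i2.right_of_append
  have hn := hperm.nodup_iff.2 hN
  -- Each piece, including `X`, is matched along its own first, third, … edges, while `σ` is kept
  -- elsewhere: the result is again a perfect matching.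
  obtain ⟨τ, hτ, hpair, -⟩ := exists_repair (H := H) (σ := σ) hσ.1
    (l := P ++ A₁ ++ B₁ ++ A₂ ++ B₂ ++ Q ++ X)
    (fun x hx => hperm.mem_iff.2 (hinv x (hperm.mem_iff.1 hx)))
    (fun x _ => hσ.2 x)
    (((((((PairAdj.of_chain hP e1).append (.of_chain cA₁ e2)).append (.of_chain cB₁ e3)).append
      (.of_chain cA₂ e4)).append (.of_chain cB₂ e5)).append (.of_chain cQ e6)).append
      (.of_chain hX e7)) hn
  have k1 := hpair.of_append (by simp [*, parity_simps])
  have k2 := k1.1.of_append (by simp [*, parity_simps])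
  have k3 := k2.1.of_append (by simp [*, parity_simps])
  have k4 := k3.1.of_append (by simp [*, parity_simps])
  have k5 := k4.1.of_append (by simp [*, parity_simps])
  have k6 := k5.1.of_append (by simp [*, parity_simps])
  exact ⟨τ, P, A₁, B₁, A₂, B₂, Q, b₁, b₂, ⟨hτ, ⟨k6.1, k6.2, k5.2, k4.2, k3.2, k2.2⟩,
    (List.nodup_append.1 hn).1, hP, hhead, hlast, h₁, h₂⟩, hv⟩

end SterboulDeming

/-! ### From lists to walks: matchings, blossoms and posies -/

namespace SterboulDeming

section Walks

variable {V : Type*} {G : SimpleGraph V} {σ : V → V}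

/-- The perfect matching encoded by a pairing. -/
def IsPairing.toSubgraph (hσ : IsPairing G σ) : G.Subgraph where
  verts := Set.univ
  Adj x y := y = σ x
  adj_sub := by rintro x _ rfl; exact hσ.2 x
  edge_vert := fun _ => trivial
  symm := ⟨by rintro x _ rfl; exact (hσ.1 x).symm⟩

theorem IsPairing.isPerfectMatching (hσ : IsPairing G σ) : hσ.toSubgraph.IsPerfectMatching :=
  SimpleGraph.Subgraph.isPerfectMatching_iff.2 fun x => ⟨σ x, rfl, fun _ h => h⟩

theorem exists_isPairing {M : G.Subgraph} (hM : M.IsPerfectMatching) :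
    ∃ σ, IsPairing G σ ∧ ∀ x y, M.Adj x y ↔ y = σ x := by
  have h := SimpleGraph.Subgraph.isPerfectMatching_iff.1 hM
  choose σ hσ hσ' using h
  have key : ∀ x y, M.Adj x y ↔ y = σ x := fun x y => ⟨hσ' x y, by rintro rfl; exact hσ x⟩
  exact ⟨σ, ⟨fun x => ((key _ _).1 (hσ x).symm).symm, fun x => (hσ x).adj_sub⟩, key⟩

theorem two_mul_ncard_edgeSet [Finite V] {M : G.Subgraph} (hM : M.IsMatching) :
    2 * M.edgeSet.ncard = M.verts.ncard := by
  classical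
  have := Fintype.ofFinite V
  have h := M.spanningCoe.sum_degrees_eq_twice_card_edges
  have h1 : ∀ v, M.spanningCoe.degree v = if v ∈ M.verts then 1 else 0 := by
    intro v
    rw [SimpleGraph.Subgraph.degree_spanningCoe]
    split_ifs with hv
    · exact SimpleGraph.Subgraph.isMatching_iff_forall_degree.1 hM v hv
    · exact SimpleGraph.Subgraph.degree_of_notMem_verts hv
  rw [Finset.sum_congr rfl fun v _ => h1 v] at h
  rw [← SimpleGraph.Subgraph.edgeSet_spanningCoe, ← SimpleGraph.coe_edgeFinset,
    Set.ncard_coe_finset, ← h]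
  simp [Set.ncard_eq_toFinset_card', Set.toFinset]

theorem isMaximumMatching_of_isPerfectMatching [Finite V] {M : G.Subgraph}
    (hM : M.IsPerfectMatching) : IsMaximumMatching M := by
  refine ⟨hM.1, fun M' hM' => ?_⟩
  have h := two_mul_ncard_edgeSet hM'
  have h' := two_mul_ncard_edgeSet hM.1
  have : M'.verts.ncard ≤ M.verts.ncard :=
    Set.ncard_le_ncard (fun x _ => hM.2 x) (Set.toFinite _)
  omega

theorem IsMaximumMatching.isPerfectMatching [Finite V] {M M' : G.Subgraph}
    (hM : IsMaximumMatching M) (hM' : M'.IsPerfectMatching) : M.IsPerfectMatching := by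
  refine ⟨hM.1, ?_⟩
  have h := two_mul_ncard_edgeSet hM.1
  have h' := two_mul_ncard_edgeSet hM'.1
  have h2 := hM.2 M' hM'.1
  rw [SimpleGraph.Subgraph.isSpanning_iff.1 hM'.2] at h'
  have : M.verts = Set.univ := Set.eq_of_subset_of_ncard_le (Set.subset_univ _) (by omega)
    (Set.toFinite _)
  exact SimpleGraph.Subgraph.isSpanning_iff.2 this

variable {M : G.Subgraph}

theorem isMMPath_of_support (hσ : IsPairing G σ) (hM : ∀ x y, M.Adj x y ↔ y = σ x)
    {u v : V} (p : G.Walk u v) (hp : Paired σ p.support) (hn : p.support.Nodup) :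
    IsMMPath M p := by
  refine ⟨p.isPath_def.2 hn, ?_⟩
  generalize hP : p.support = P at hp hn
  induction hp generalizing u v p with
  | nil => simp at hP
  | @cons x l hl ih =>
    cases p with
    | nil => simp at hP
    | @cons _ w _ h q =>
      simp only [SimpleGraph.Walk.support_cons, List.cons.injEq] at hP
      obtain ⟨rfl, hq⟩ := hP
      cases q with
      | nil =>
        simp only [SimpleGraph.Walk.support_nil, List.cons.injEq] at hq
        simp [IsAlternating, hM, hq.1]
      | @cons _ y _ h' q =>
        simp only [SimpleGraph.Walk.support_cons, List.cons.injEq] at hq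
        obtain ⟨rfl, hq⟩ := hq
        simp only [List.nodup_cons] at hn
        obtain ⟨h1, ⟨e, he, heM⟩, h3⟩ := ih q hq hn.2.2
        have hy : y ∈ l := hq ▸ q.start_mem_support
        -- The edge leaving `σ u` does not return to `u`, so it is not a matching edge.
        have hyx : y ≠ u := by rintro rfl; simp [hy] at hn
        have n1 : s(u, σ u) ∈ M.edgeSet := by simp [hM]
        have n2 : s(σ u, y) ∉ M.edgeSet := by simp [hM, hσ.1, hyx]
        refine ⟨?_, ⟨_, by simp, n1⟩, ?_⟩
        · unfold IsAlternating at *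
          simp only [SimpleGraph.Walk.edges_cons]
          rw [List.isChain_cons_cons]
          refine ⟨.inl ⟨n1, n2⟩, h1.cons fun f hf => ?_⟩
          obtain rfl : e = f := Option.some.inj ((Option.mem_def.1 he).symm.trans hf)
          exact .inr ⟨heM, n2⟩
        · obtain ⟨f, hf, hfM⟩ := h3
          refine ⟨f, ?_, hfM⟩
          simp only [SimpleGraph.Walk.edges_cons, List.getLast?_cons, Option.mem_def] at hf ⊢
          simp [hf]

theorem ncard_pairs {L : List V} (hσ : ∀ x, σ (σ x) = x) (hL : Paired σ L) (hn : L.Nodup) :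
    2 * {e | ∃ x ∈ L, e = s(x, σ x)}.ncard = L.length := by
  induction hL with
  | nil => simp
  | @cons x l hl ih =>
    have : {e | ∃ y ∈ x :: σ x :: l, e = s(y, σ y)} =
        insert s(x, σ x) {e | ∃ y ∈ l, e = s(y, σ y)} := by
      ext e
      simp only [List.mem_cons, Set.mem_ofPred_eq, Set.mem_insert_iff]
      constructor
      · rintro ⟨y, rfl | rfl | hy, rfl⟩
        · exact .inl rfl
        · rw [hσ, Sym2.eq_swap]; exact .inl rfl
        · exact .inr ⟨y, hy, rfl⟩
      · rintro (rfl | ⟨y, hy, rfl⟩)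
        · exact ⟨x, .inl rfl, rfl⟩
        · exact ⟨y, .inr (.inr hy), rfl⟩
    simp only [List.nodup_cons, List.mem_cons, not_or] at hn
    have hfin : {e | ∃ y ∈ l, e = s(y, σ y)}.Finite := by
      refine (l.finite_toSet.image fun y => s(y, σ y)).subset ?_
      rintro _ ⟨y, hy, rfl⟩
      exact ⟨y, hy, rfl⟩
    rw [this, Set.ncard_insert_of_notMem _ hfin, mul_add, ih hn.2.2]
    · simp
    · rintro ⟨y, hy, h⟩
      rcases Sym2.eq_iff.1 h with ⟨rfl, _⟩ | ⟨_, rfl⟩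
      · exact hn.1.2 hy
      · exact hn.2.1 hy

/-- Since `L` is closed under `σ` and omits `b`, the partner of `b` is off the cycle. So the
matching edges of the cycle are exactly the pairs of `L`, half as many as its entries. -/
theorem isBlossom_of_support (hσ : IsPairing G σ) (hM : ∀ x y, M.Adj x y ↔ y = σ x)
    {b : V} (c : G.Walk b b) {L : List V} (hc : c.support = b :: L ++ [b]) (hL : Paired σ L)
    (hn : (b :: L).Nodup) : IsBlossom M c := by
  have hlen : c.length = L.length + 1 := by
    have := congrArg List.length hc
    simpa using this
  have hL0 : L ≠ [] := by
    rintro rfl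
    have h := c.isChain_adj_support
    rw [hc] at h
    simp at h
  obtain ⟨k, hk⟩ := hL.even
  have hk0 : 0 < L.length := List.length_pos_iff.2 hL0
  have hb : b ∉ L := (List.nodup_cons.1 hn).1
  have hσb : ∀ x ∈ c.support, x ≠ σ b := by
    rintro x hx rfl
    have : σ b ∈ L := by
      have hne : σ b ≠ b := fun h => (hσ.2 b).ne h.symm
      simpa [hc, hne] using hx
    exact hb (by simpa [hσ.1] using hL.mem hσ.1 this)
  have hbM : ∀ e ∈ c.edges, b ∈ e → e ∉ M.edgeSet := by
    intro e he hbe heM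
    obtain ⟨y, rfl⟩ := hbe
    have : y = σ b := (hM b y).1 heM
    exact hσb y (c.snd_mem_support_of_mem_edges he) this
  refine ⟨?_, ⟨k, by omega, ?_⟩, hbM⟩
  · rw [SimpleGraph.Walk.isCycle_iff_isPath_tail_and_le_length]
    refine ⟨?_, by omega⟩
    rw [SimpleGraph.Walk.isPath_def, SimpleGraph.Walk.support_tail_of_not_nil _
      (by rw [← SimpleGraph.Walk.length_eq_zero_iff]; omega), hc]
    exact (List.perm_append_comm (l₁ := L) (l₂ := [b])).nodup_iff.2 hn
  · have : {e | e ∈ c.edges ∧ e ∈ M.edgeSet} = {e | ∃ x ∈ L, e = s(x, σ x)} := by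
      ext e
      constructor
      · rintro ⟨he, heM⟩
        induction e with
        | h x y =>
          have hy : y = σ x := (hM x y).1 heM
          subst hy
          have hx : x ∈ c.support := c.fst_mem_support_of_mem_edges he
          have hxb : x ≠ b := by
            rintro rfl
            exact hbM _ he (by simp) heM
          exact ⟨x, by simpa [hc, hxb] using hx, rfl⟩
      · rintro ⟨x, hx, rfl⟩
        refine ⟨?_, by simp [hM]⟩
        obtain ⟨l₁, y, l₂, rfl, -, -, h⟩ := hL.split hx
        have hy : s(y, σ y) ∈ c.edges := by
          rw [← SimpleGraph.Walk.infix_support_iff_mem_edges]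
          exact .inl ⟨b :: l₁, l₂ ++ [b], by simp [hc]⟩
        rcases h with rfl | rfl
        · exact hy
        · rwa [hσ.1, Sym2.eq_swap]
    rw [this]
    have := ncard_pairs hσ.1 hL (List.nodup_cons.1 hn).2
    omega

theorem exists_walk_of_chain {l : List V} {u v : V} (hl : l.IsChain G.Adj)
    (hu : l.head? = some u) (hv : l.getLast? = some v) : ∃ p : G.Walk u v, p.support = l := by
  have hne : l ≠ [] := by rintro rfl; simp at hu
  obtain rfl : l.head hne = u := by simpa [List.head?_eq_some_head hne] using hu
  obtain rfl : l.getLast hne = v := by simpa [List.getLast?_eq_some_getLast hne] using hv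
  exact ⟨.ofSupport l hne hl, SimpleGraph.Walk.support_ofSupport hne hl⟩

end Walks

theorem mem_and_mem_iff {V : Type*} {A₁ B₁ A₂ B₂ Q : List V} {b₁ b₂ : V}
    (hn : (A₁ ++ B₁ ++ A₂ ++ B₂ ++ Q).Nodup) (n₁ : b₁ ∉ A₁ ++ B₁ ++ A₂ ++ B₂ ++ Q)
    (n₂ : b₂ ∉ A₁ ++ B₁ ++ A₂ ++ B₂ ++ Q) (hne : b₁ ≠ b₂) (x : V) :
    (x ∈ b₁ :: (A₁ ++ Q ++ B₁) ++ [b₁] ∧ x ∈ b₂ :: (A₂ ++ Q ++ B₂) ++ [b₂]) ↔ x ∈ Q := by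
  have h1 : (A₁ ++ B₁).Disjoint (A₂ ++ B₂) := by
    simp only [List.append_assoc] at hn ⊢
    rw [← List.append_assoc A₁] at hn
    intro y hy hy'
    refine (List.nodup_append.1 hn).2.2 y hy y ?_ rfl
    simp only [List.mem_append] at hy' ⊢
    tauto
  constructor
  · rintro ⟨h, h'⟩
    by_contra hQ
    simp only [List.mem_append, List.mem_cons, List.not_mem_nil, or_false, not_or] at *
    have h2 : x = b₁ ∨ x ∈ A₁ ∨ x ∈ B₁ := by tauto
    have h3 : x = b₂ ∨ x ∈ A₂ ∨ x ∈ B₂ := by tauto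
    rcases h2 with rfl | h2
    · rcases h3 with rfl | h3
      · exact hne rfl
      · tauto
    · rcases h3 with rfl | h3
      · tauto
      · exact h1 (by simpa using h2) (by simpa using h3)
  · intro h
    simp [h]

/-- Used to see that the blossoms share no edge beyond those of `Q`. The entry `x` occurs only once,
so its successor on the cycle is determined; if `x` ended `Q`, that successor would lie in `B` or be
`b`, both off `Q`. -/
theorem infix_of_infix_closed {V : Type*} {A B Q : List V} {b x y : V}
    (hn : (b :: (A ++ Q ++ B)).Nodup) (h : [x, y] <:+: b :: (A ++ Q ++ B) ++ [b])
    (hx : x ∈ Q) (hy : y ∈ Q) : [x, y] <:+: Q := by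
  classical
  obtain ⟨s, t, hst⟩ := h
  obtain ⟨Q₁, Q₂, rfl⟩ := List.append_of_mem hx
  have hxb : b ≠ x := by
    rintro rfl
    simp at hn
  have hcount := List.nodup_iff_count_le_one.1 hn
  have hcx := hcount x
  simp only [List.count_append, List.count_cons] at hcx
  have hxx : (if (x == x) = true then 1 else 0) = 1 := by simp
  have hx1 : x ∉ b :: (A ++ Q₁) := by
    rw [← List.count_eq_zero]
    simp only [List.count_append, List.count_cons]
    omega
  have hx2 : x ∉ Q₂ ++ B ++ [b] := by
    rw [← List.count_eq_zero]
    simp only [List.count_append, List.count_cons, List.count_nil]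
    omega
  obtain ⟨-, -, h3⟩ := (List.append_cons_inj_of_notMem (x₂ := s) (z₂ := y :: t) (a₁ := x) hx1 hx2).1
    (by simpa using hst.symm)
  cases Q₂ with
  | nil =>
    exfalso
    have hyB : y ∈ B ++ [b] := by
      have : y ∈ [] ++ B ++ [b] := by rw [h3]; simp
      simpa using this
    have h1 := List.count_pos_iff.2 hyB
    have h2 := List.count_pos_iff.2 hy
    have hcy := hcount y
    simp only [List.count_append, List.count_cons, List.count_nil] at hcy h1 h2
    omega
  | cons z Q₂ =>
    simp only [List.cons_append, List.cons.injEq] at h3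
    exact ⟨Q₁, Q₂, by simp [h3.1]⟩

theorem nodup_blossom {V : Type*} {A₁ B₁ A₂ B₂ Q : List V}
    (hn : (A₁ ++ B₁ ++ A₂ ++ B₂ ++ Q).Nodup) : (A₁ ++ Q ++ B₁).Nodup := by
  classical
  refine List.nodup_iff_count_le_one.2 fun a => ?_
  have := List.nodup_iff_count_le_one.1 hn a
  simp only [List.count_append] at this ⊢
  omega

set_option maxHeartbeats 1000000 in
theorem PosyData.isTPosy {V : Type*} {G : SimpleGraph V} {σ : V → V}
    {P A₁ B₁ A₂ B₂ Q : List V} {b₁ b₂ : V} (h : PosyData G σ P A₁ B₁ A₂ B₂ Q b₁ b₂) :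
    ∃ (c₁ : G.Walk b₁ b₁) (p : G.Walk b₁ b₂) (c₂ : G.Walk b₂ b₂),
      IsTPosy h.pairing.toSubgraph c₁ p c₂ ∧ c₁.support = b₁ :: (A₁ ++ Q ++ B₁) ++ [b₁] ∧
      p.support = P ∧ c₂.support = b₂ :: (A₂ ++ Q ++ B₂) ++ [b₂] := by
  obtain ⟨hσ, ⟨pP, pA₁, pB₁, pA₂, pB₂, pQ⟩, hn, hP, hh, hl, k₁, k₂⟩ := h
  have hM : ∀ x y, hσ.toSubgraph.Adj x y ↔ y = σ x := fun _ _ => Iff.rfl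
  have hb₁ : b₁ ∈ P := List.mem_of_mem_head? hh
  have hb₂ : b₂ ∈ P := List.mem_of_getLast? hl
  have hpl : P.Nodup ∧ ∀ x ∈ P, x ∉ A₁ ++ B₁ ++ A₂ ++ B₂ ++ Q := by
    simp only [List.append_assoc] at hn ⊢
    have := List.nodup_append.1 hn
    exact ⟨this.1, fun x hx hx' => this.2.2 x hx x hx' rfl⟩
  have hne : b₁ ≠ b₂ := by
    rintro rfl
    cases pP with
    | nil => simp at hh
    | @cons x l hl' =>
      simp only [List.head?_cons, Option.some.injEq] at hh
      subst hh
      simp only [List.getLast?_cons_cons] at hl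
      have := List.mem_of_getLast? hl
      have := hpl.1
      simp_all
  obtain ⟨p, hp⟩ := exists_walk_of_chain hP hh hl
  obtain ⟨c₁, hc₁⟩ := exists_walk_of_chain (u := b₁) (v := b₁) k₁ (by simp)
    (List.getLast?_concat ..)
  obtain ⟨c₂, hc₂⟩ := exists_walk_of_chain (u := b₂) (v := b₂) k₂ (by simp)
    (List.getLast?_concat ..)
  refine ⟨c₁, p, c₂, ⟨?_, ?_, ?_, ?_, ?_⟩, hc₁, hp, hc₂⟩
  · refine isBlossom_of_support hσ hM c₁ hc₁ ((pA₁.append pQ).append pB₁) ?_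
    have := hpl.2 b₁ hb₁
    grind
  · refine isBlossom_of_support hσ hM c₂ hc₂ ((pA₂.append pQ).append pB₂) ?_
    have := hpl.2 b₂ hb₂
    grind
  · exact isMMPath_of_support hσ hM p (hp ▸ pP) (hp ▸ hpl.1)
  · intro x hx h1 h2
    have := hpl.2 x (hp ▸ hx)
    rw [hc₁, hc₂]
    grind
  · have n1 := hpl.2 b₁ hb₁
    have n2 := hpl.2 b₂ hb₂
    have hn' : (A₁ ++ B₁ ++ A₂ ++ B₂ ++ Q).Nodup := by
      simp only [List.append_assoc] at hn ⊢
      exact (List.nodup_append.1 hn).2.1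
    have key : ∀ x, x ∈ c₁.support ∧ x ∈ c₂.support ↔ x ∈ Q := by
      rw [hc₁, hc₂]
      exact mem_and_mem_iff hn' n1 n2 hne
    -- An empty `Q` gives a barbell, a non-empty one a subdivided complete graph on four vertices.
    by_cases hQ : Q = []
    · subst hQ
      exact .inl fun x hx hx' => by simpa using (key x).1 ⟨hx, hx'⟩
    · right
      have hQc : Q.IsChain G.Adj := k₁.inner.left_of_append.right_of_append
      obtain ⟨q, hq⟩ := exists_walk_of_chain (u := Q.head hQ) (v := Q.getLast hQ) hQc
        (List.head?_eq_some_head hQ) (List.getLast?_eq_some_getLast hQ)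
      refine ⟨_, _, q, isMMPath_of_support hσ hM q (by rwa [hq]) ?_, ?_⟩
      · rw [hq]
        exact (List.nodup_append.1 hn).2.1
      · have hsub : ∀ (b : V) (A B : List V) (c : G.Walk b b), c.support = b :: (A ++ Q ++ B) ++ [b] →
            ∀ e ∈ q.edges, e ∈ c.edges := by
          intro b A B c hc e he
          induction e with
          | h x y =>
            rw [← SimpleGraph.Walk.infix_support_iff_mem_edges] at he ⊢
            have hi : q.support <:+: c.support := ⟨b :: A, B ++ [b], by simp [hc, hq]⟩
            exact he.imp (·.trans hi) (·.trans hi)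
        have hcon : ∀ x y, [x, y] <:+: c₁.support → x ∈ Q → y ∈ Q → [x, y] <:+: q.support := by
          intro x y h hx hy
          rw [hc₁] at h
          rw [hq]
          refine infix_of_infix_closed ?_ h hx hy
          refine List.nodup_cons.2 ⟨fun h => n1 ?_, ?_⟩
          · simp only [List.mem_append] at h ⊢
            tauto
          · exact nodup_blossom hn'
        ext x y
        · simp [key, hq]
        · simp only [SimpleGraph.Subgraph.inf_adj, SimpleGraph.Walk.adj_toSubgraph_iff_mem_edges]
          constructor
          · rintro ⟨h1, h2⟩
            have hx := (key x).1 ⟨c₁.fst_mem_support_of_mem_edges h1,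
              c₂.fst_mem_support_of_mem_edges h2⟩
            have hy := (key y).1 ⟨c₁.snd_mem_support_of_mem_edges h1,
              c₂.snd_mem_support_of_mem_edges h2⟩
            rw [← SimpleGraph.Walk.infix_support_iff_mem_edges] at h1 ⊢
            exact h1.imp (hcon x y · hx hy) (hcon y x · hy hx)
          · intro h
            exact ⟨hsub _ _ _ c₁ hc₁ _ h, hsub _ _ _ c₂ hc₂ _ h⟩

theorem HasPosy.mem_SD {V : Type*} [Finite V] {G : SimpleGraph V} {v : V} (h : HasPosy G v) :
    v ∈ SD G := by
  obtain ⟨σ, P, A₁, B₁, A₂, B₂, Q, b₁, b₂, hp, hv⟩ := h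
  obtain ⟨c₁, p, c₂, h, h1, h2, h3⟩ := hp.isTPosy
  refine ⟨_, isMaximumMatching_of_isPerfectMatching hp.pairing.isPerfectMatching, .inl
    ⟨b₁, b₂, c₁, p, c₂, h, ?_⟩⟩
  rw [h1, h2, h3]
  simp only [List.mem_append, List.mem_cons] at hv ⊢
  tauto

end SterboulDeming

/-! ### Tight sets and their spread along alternating paths -/

namespace SterboulDeming

/-- `S` is independent, and the partner of every neighbour of `S` lies in `S`. -/
def IsTight {V : Type*} (H : SimpleGraph V) (σ : V → V) (S : Set V) : Prop :=
  (∀ x ∈ S, ∀ y ∈ S, ¬ H.Adj x y) ∧ ∀ x ∈ S, ∀ y, H.Adj x y → σ y ∈ S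

section Tight

variable {V : Type*} {H : SimpleGraph V} {σ : V → V} {S : Set V}

theorem mem_neighbors {y : V} : y ∈ neighbors H S ↔ ∃ x ∈ S, H.Adj x y := by
  simp [neighbors, SimpleGraph.mem_neighborSet]

theorem IsPairing.image_subset (hσ : IsPairing H σ) : σ '' S ⊆ neighbors H S := by
  rintro _ ⟨x, hx, rfl⟩
  exact mem_neighbors.2 ⟨x, hx, hσ.2 x⟩

/-- The image of `S` under the injection `σ` lies in N(S), and tightness says that it fills N(S).
The right-hand side does not mention `σ`, so all perfect matchings have the same tight sets. -/
theorem isTight_iff [Finite V] (hσ : IsPairing H σ) : IsTight H σ S ↔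
    (∀ x ∈ S, ∀ y ∈ S, ¬ H.Adj x y) ∧ (neighbors H S).ncard ≤ S.ncard := by
  have hinj : Function.Injective σ := Function.LeftInverse.injective hσ.1
  have hcard : (σ '' S).ncard = S.ncard := Set.ncard_image_of_injective S hinj
  refine and_congr_right fun _ => ⟨fun h => ?_, fun h x hx y hxy => ?_⟩
  · rw [← hcard]
    refine Set.ncard_le_ncard (fun y hy => ?_) (Set.toFinite _)
    obtain ⟨x, hx, hxy⟩ := mem_neighbors.1 hy
    exact ⟨σ y, h x hx y hxy, hσ.1 y⟩
  · have heq : σ '' S = neighbors H S :=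
      Set.eq_of_subset_of_ncard_le hσ.image_subset (by omega) (Set.toFinite _)
    have : y ∈ σ '' S := heq ▸ mem_neighbors.2 ⟨x, hx, hxy⟩
    obtain ⟨z, hz, rfl⟩ := this
    rwa [hσ.1]

/-- From `x` in `S` the path steps to a neighbour and then to that neighbour's partner, which
tightness puts back into `S`. -/
theorem IsTight.forward (hS : IsTight H σ S) {x β : V} {L : List V} (hL : Paired σ L)
    (hc : (x :: L).IsChain H.Adj) (hx : x ∈ S) (hβ : (x :: L).getLast? = some β) : β ∈ S := by
  induction hL generalizing x with
  | nil => simp at hβ; exact hβ ▸ hx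
  | @cons y l _ ih =>
    rw [List.isChain_cons_cons, ] at hc
    exact ih (List.isChain_cons.1 hc.2).2 (hS.2 x hx y hc.1) (by simpa using hβ)

theorem IsTight.forward_pth (hS : IsTight H σ S) {x z : V} {L : List V} (hL : Paired σ L)
    (hc : Pth H.Adj x L z) (hx : x ∈ S) : σ z ∈ S := by
  obtain ⟨β, hβ⟩ : ∃ β, (x :: L).getLast? = some β :=
    ⟨_, List.getLast?_eq_some_getLast (List.cons_ne_nil x L)⟩
  have h1 := hS.forward hL hc.left hx hβ
  refine hS.2 β h1 z ?_
  exact (List.isChain_append.1 hc).2.2 β hβ z (by simp)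

theorem IsTight.partner_not_mem (hσ : IsPairing H σ) (hS : IsTight H σ S) {x : V}
    (hx : x ∈ S) : σ x ∉ S := fun h => hS.1 x hx _ h (hσ.2 x)

/-- Going once around the blossom from `b` in `S` would give `σ b` in `S`, an edge inside `S`. -/
theorem IsTight.base_not_mem (hσ : IsPairing H σ) (hS : IsTight H σ S) {b : V} {L : List V}
    (hL : Paired σ L) (hc : Pth H.Adj b L b) : b ∉ S :=
  fun hb => hS.partner_not_mem hσ hb (hS.forward_pth hL hc hb)

/-- From `x`, move away from its partner: this direction is the one in which membership spreads. -/
theorem IsTight.partner_base_mem (hσ : IsPairing H σ) (hS : IsTight H σ S) {b x y : V}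
    {L : List V} (hL : Paired σ L) (hc : Pth H.Adj b L y) (hx : x ∈ L) (hxS : x ∈ S) :
    σ b ∈ S ∨ σ y ∈ S := by
  obtain ⟨l₁, z, l₂, rfl, h₁, h₂, h⟩ := hL.split hx
  rw [List.append_assoc, List.cons_append, List.cons_append, List.nil_append, pth_append_cons,
    pth_cons] at hc
  rcases h with rfl | rfl
  · exact .inl (hS.forward_pth (h₁.reverse hσ.1) (hc.1.reverse fun _ _ h => h.symm) hxS)
  · exact .inr (hS.forward_pth h₂ hc.2.2 hxS)

/-- A vertex of `S` in the first blossom forces `σ b₁` into `S`; the joining path carries this to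
`b₂`, which as a base cannot be in `S`. -/
theorem IsTight.not_mem_blossom (hσ : IsPairing H σ) (hS : IsTight H σ S) {b₁ b₂ v : V}
    {P L₁ L₂ : List V} (hP : Paired σ P) (hL₁ : Paired σ L₁) (hL₂ : Paired σ L₂)
    (hc : P.IsChain H.Adj) (hh : P.head? = some b₁) (hl : P.getLast? = some b₂)
    (h₁ : Pth H.Adj b₁ L₁ b₁) (h₂ : Pth H.Adj b₂ L₂ b₂) (hv : v ∈ L₁) : v ∉ S := by
  intro hvS
  have hb : σ b₁ ∈ S := (hS.partner_base_mem hσ hL₁ h₁ hv hvS).elim id id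
  cases hP with
  | nil => simp at hh
  | @cons x l hP =>
    obtain rfl : x = b₁ := by simpa using hh
    exact hS.base_not_mem hσ hL₂ h₂
      (hS.forward hP (List.isChain_cons.1 hc).2 hb (by simpa using hl))

/-- A tight set meeting an alternating path with matching end edges contains one of its ends. -/
theorem IsTight.end_mem (hσ : IsPairing H σ) (hS : IsTight H σ S) {b₁ b₂ v : V}
    {P : List V} (hP : Paired σ P) (hc : P.IsChain H.Adj) (hh : P.head? = some b₁)
    (hl : P.getLast? = some b₂) (hv : v ∈ P) (hvS : v ∈ S) : b₁ ∈ S ∨ b₂ ∈ S := by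
  obtain ⟨l₁, y, l₂, rfl, k₁, k₂, h⟩ := hP.split hv
  rcases h with rfl | rfl
  · refine .inl (hS.forward (k₁.reverse hσ.1) ?_ hvS (β := b₁) ?_)
    · have : (l₁ ++ [v]).IsChain H.Adj := by
        have : (l₁ ++ [v] ++ (σ v :: l₂)).IsChain H.Adj := by simpa using hc
        exact this.left_of_append
      simpa using isChain_reverse_of_symm (fun _ _ h => h.symm) this
    · cases l₁ <;> simp_all [List.getLast?_cons]
  · refine .inr (hS.forward k₂ ?_ hvS (β := b₂) ?_)
    · have : (l₁ ++ [y] ++ (σ y :: l₂)).IsChain H.Adj := by simpa using hc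
      exact this.right_of_append
    · simpa using hl

theorem IsTight.not_mem_stem (hσ : IsPairing H σ) (hS : IsTight H σ S) {b₁ b₂ v : V}
    {P L₁ L₂ : List V} (hP : Paired σ P) (hL₁ : Paired σ L₁) (hL₂ : Paired σ L₂)
    (hc : P.IsChain H.Adj) (hh : P.head? = some b₁) (hl : P.getLast? = some b₂)
    (h₁ : Pth H.Adj b₁ L₁ b₁) (h₂ : Pth H.Adj b₂ L₂ b₂) (hv : v ∈ P) : v ∉ S := fun hvS =>
  (hS.end_mem hσ hP hc hh hl hv hvS).elim (hS.base_not_mem hσ hL₁ h₁) (hS.base_not_mem hσ hL₂ h₂)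

end Tight

/-! ### From posies to lists; the expansion of independent sets -/

section PosyToLists

variable {V : Type*} {G : SimpleGraph V} {σ : V → V} {M : G.Subgraph}

theorem paired_of_isMMPath (hM : ∀ x y, M.Adj x y ↔ y = σ x) {u v : V} {p : G.Walk u v}
    (hp : IsMMPath M p) : Paired σ p.support := by
  obtain ⟨-, ha, hh, hl⟩ := hp
  induction hn : p.length using Nat.strong_induction_on generalizing u with
  | _ n ih =>
    cases p with
    | nil => simp at hh
    | @cons _ w _ h q =>
      have hw : w = σ u := by simpa [hM] using hh
      cases q with
      | nil =>
        subst hw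
        exact .cons u .nil
      | @cons _ y _ h' q =>
        unfold IsAlternating at ha
        simp only [SimpleGraph.Walk.edges_cons] at ha hl
        rw [List.isChain_cons_cons] at ha
        have h1 : s(u, w) ∈ M.edgeSet := by simp [hM, hw]
        have h2 : s(w, y) ∉ M.edgeSet := by
          rcases ha.1 with h | h
          · exact h.2
          · exact absurd h1 h.2
        subst hw
        refine .cons u (ih q.length (by simp [← hn]) (p := q) ?_ ?_ ?_ rfl)
        · exact (List.isChain_cons.1 ha.2).2
        · cases q with
          | nil => simp [h2] at hl
          | @cons _ z _ h'' q =>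
            simp only [SimpleGraph.Walk.edges_cons] at ha ⊢
            rw [List.isChain_cons_cons] at ha
            rcases ha.2.1 with h | h
            · exact absurd h.1 h2
            · exact ⟨_, rfl, h.1⟩
        · obtain ⟨e, he, heM⟩ := hl
          cases q with
          | nil =>
            simp only [SimpleGraph.Walk.edges_nil] at he
            obtain rfl : s(σ u, v) = e := by simpa using he
            exact absurd heM h2
          | @cons _ z _ h'' q =>
            refine ⟨e, ?_, heM⟩
            simpa [List.getLast?_cons] using he

/-- A path has at most half (rounded up) of its edges in a matching; equality forces the matching
edges to be the first, third, … last ones. -/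
theorem countP_path_edges [DecidablePred (· ∈ M.edgeSet)] (hσ : ∀ x, σ (σ x) = x)
    (hM : ∀ x y, M.Adj x y ↔ y = σ x) {u v : V} (p : G.Walk u v) (hp : p.IsPath) :
    2 * p.edges.countP (· ∈ M.edgeSet) ≤ p.length + 1 ∧
      (2 * p.edges.countP (· ∈ M.edgeSet) = p.length + 1 → Paired σ p.support) := by
  induction hn : p.length using Nat.strong_induction_on generalizing u with
  | _ n ih =>
    cases p with
    | nil => simp at hn; subst hn; simp
    | @cons _ w _ h q =>
      have hq := (SimpleGraph.Walk.cons_isPath_iff h q).1 hp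
      simp only [SimpleGraph.Walk.length_cons] at hn
      simp only [SimpleGraph.Walk.edges_cons, List.countP_cons, SimpleGraph.Walk.support_cons]
      by_cases hw : w = σ u
      · have h1 : s(u, w) ∈ M.edgeSet := by simp [hM, hw]
        cases q with
        | nil =>
          simp at hn
          subst hn
          subst hw
          simp [h1]
          exact .cons u .nil
        | @cons _ y _ h' q =>
          have hq' := (SimpleGraph.Walk.cons_isPath_iff h' q).1 hq.1
          have hyu : y ≠ u := by
            rintro rfl
            exact hq.2 (by simp)
          have h2 : s(w, y) ∉ M.edgeSet := by
            simp [hM, hw, hσ, hyu]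
          simp only [SimpleGraph.Walk.length_cons] at hn
          obtain ⟨i1, i2⟩ := ih q.length (by omega) q hq'.1 rfl
          subst hw
          simp only [SimpleGraph.Walk.edges_cons, List.countP_cons, SimpleGraph.Walk.support_cons,
            h1, h2, decide_true, decide_false, if_true]
          refine ⟨?_, fun h => .cons u (i2 ?_)⟩
          · simp; omega
          · simp at h; omega
      · have h1 : s(u, w) ∉ M.edgeSet := by simp [hM, hw]
        obtain ⟨i1, i2⟩ := ih q.length (by omega) q hq.1 rfl
        simp only [h1, decide_false]
        refine ⟨?_, fun h => ?_⟩
        · simp; omega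
        · simp at h; omega

/-- Removing the base leaves a path of length 2k - 1 that still has all k matching edges, the
extremal case of `countP_path_edges`. -/
theorem exists_paired_of_isBlossom (hσ : ∀ x, σ (σ x) = x) (hM : ∀ x y, M.Adj x y ↔ y = σ x)
    {b : V} {c : G.Walk b b} (hc : IsBlossom M c) :
    ∃ L, c.support = b :: L ++ [b] ∧ Paired σ L := by
  classical
  obtain ⟨hcyc, ⟨k, hk, hcard⟩, hb⟩ := hc
  have hcard' : c.edges.countP (· ∈ M.edgeSet) = k := by
    rw [← hcard, List.countP_eq_length_filter]
    have hnd : (c.edges.filter (· ∈ M.edgeSet)).Nodup := hcyc.1.1.edges_nodup.filter _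
    rw [← List.toFinset_card_of_nodup hnd, ← Set.ncard_coe_finset]
    congr 1
    ext e
    simp
  cases c with
  | nil => simp at hk
  | @cons _ w _ h q =>
    obtain ⟨z, q', h', rfl⟩ : ∃ z, ∃ (q' : G.Walk w z) (h' : G.Adj z b), q = q'.concat h' := by
      cases q with
      | nil => exact absurd h (G.loopless.irrefl _)
      | cons h2 q2 =>
        obtain ⟨z, q', h', hq⟩ := SimpleGraph.Walk.exists_cons_eq_concat h2 q2
        exact ⟨z, q', h', hq⟩
    have hpath := (SimpleGraph.Walk.concat_isPath_iff h').1
      ((SimpleGraph.Walk.cons_isCycle_iff _ h).1 hcyc).1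
    have n1 : s(b, w) ∉ M.edgeSet := hb _ (by simp) (by simp)
    have n2 : s(z, b) ∉ M.edgeSet := hb _ (by simp) (by simp)
    refine ⟨q'.support, by simp [SimpleGraph.Walk.support_concat],
      (countP_path_edges hσ hM q' hpath.1).2 ?_⟩
    simp only [SimpleGraph.Walk.edges_cons, SimpleGraph.Walk.edges_concat, List.countP_cons, n1,
      List.concat_eq_append, List.countP_append, n2, List.countP_nil, decide_false,
      SimpleGraph.Walk.length_cons, SimpleGraph.Walk.length_concat] at hcard' hk
    simp at hcard'
    omega

theorem IsTight.not_mem_posy {S : Set V} (hσ : IsPairing G σ) (hM : ∀ x y, M.Adj x y ↔ y = σ x)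
    (hS : IsTight G σ S) {v : V} (hv : LiesInTPosy M v) : v ∉ S := by
  obtain ⟨b₁, b₂, c₁, p, c₂, ⟨hc₁, hc₂, hp, -, -⟩, hv⟩ := hv
  obtain ⟨L₁, hs₁, hL₁⟩ := exists_paired_of_isBlossom hσ.1 hM hc₁
  obtain ⟨L₂, hs₂, hL₂⟩ := exists_paired_of_isBlossom hσ.1 hM hc₂
  have hP := paired_of_isMMPath hM hp
  have h₁ : Pth G.Adj b₁ L₁ b₁ := by
    unfold Pth; rw [← hs₁]; exact c₁.isChain_adj_support
  have h₂ : Pth G.Adj b₂ L₂ b₂ := by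
    unfold Pth; rw [← hs₂]; exact c₂.isChain_adj_support
  have hc := p.isChain_adj_support
  have hh : p.support.head? = some b₁ := by
    rw [List.head?_eq_some_head p.support_ne_nil, SimpleGraph.Walk.head_support]
  have hl : p.support.getLast? = some b₂ := by
    rw [List.getLast?_eq_some_getLast p.support_ne_nil, SimpleGraph.Walk.getLast_support]
  have hstem : ∀ x ∈ p.support, x ∉ S := fun x hx =>
    hS.not_mem_stem hσ hP hL₁ hL₂ hc hh hl h₁ h₂ hx
  rw [hs₁, hs₂] at hv
  simp only [List.cons_append, List.mem_cons, List.mem_append, List.not_mem_nil, or_false] at hv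
  rcases hv with (rfl | hv | rfl) | hv | (rfl | hv | rfl)
  · exact hstem _ (by simp)
  · exact hS.not_mem_blossom hσ hP hL₁ hL₂ hc hh hl h₁ h₂ hv
  · exact hstem _ (by simp)
  · exact hstem _ hv
  · exact hstem _ (by simp)
  · exact hS.not_mem_blossom hσ (hP.reverse hσ.1) hL₂ hL₁
      (isChain_reverse_of_symm (fun _ _ h => h.symm) hc) (by simpa using hl) (by simpa using hh)
      h₂ h₁ hv
  · exact hstem _ (by simp)

/-- In a graph with a perfect matching, independent sets through `SD G` expand. -/
theorem ncard_lt_ncard_neighbors [Finite V] {N : G.Subgraph} (hN : N.IsPerfectMatching)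
    {S : Set V} (hS : G.IsIndepSet S) {v : V} (hv : v ∈ S) (hvD : v ∈ SD G) :
    S.ncard < (neighbors G S).ncard := by
  by_contra! hle
  obtain ⟨M, hM, hv'⟩ := hvD
  have hMp := hM.isPerfectMatching hN
  obtain ⟨σ, hσ, hMσ⟩ := exists_isPairing hMp
  have hT : IsTight G σ S := by
    refine (isTight_iff hσ).2 ⟨fun x hx y hy hxy => ?_, hle⟩
    exact hS hx hy hxy.ne hxy
  -- The flower case is void: its stem would end at a vertex missed by a perfect matching.
  rcases hv' with hv' | ⟨b, r, c, p, ⟨-, -, -, -, hr, -⟩, -⟩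
  · exact hT.not_mem_posy hσ hMσ hv' hv
  · exact hr (hMp.2 r)

end PosyToLists

end SterboulDeming

/-! ### Good vertices, frames and attachments -/

namespace SterboulDeming

/-- `H` has a perfect matching, and no pair of `v` in it meets a tight set. -/
def Good {V : Type*} (H : SimpleGraph V) (v : V) : Prop :=
  ∃ σ, IsPairing H σ ∧ ∀ S, IsTight H σ S → v ∉ S ∧ σ v ∉ S

/-- Adjacency of vertices of different colours. -/
def CAdj {V : Type*} (H : SimpleGraph V) (χ : V → Bool) (x y : V) : Prop :=
  H.Adj x y ∧ χ x ≠ χ y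

/-- `zs` lists an even cycle through `v`, alternately coloured by `χ` (or a single edge), which is
a union of pairs of `σ` with ends of different colours. -/
structure Frame {V : Type*} (H : SimpleGraph V) (σ : V → V) (χ : V → Bool) (zs : List V)
    (v : V) : Prop where
  nodup : zs.Nodup
  cyc : ∀ a ∈ zs, ∃ t, (a :: t).Perm zs ∧ Pth (CAdj H χ) a t a
  inv : ∀ z ∈ zs, σ z ∈ zs
  flip : ∀ z ∈ zs, χ (σ z) ≠ χ z
  mem : v ∈ zs

/-- An alternating path through `L` joining two vertices of `zs`, otherwise disjoint from `zs`. -/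
structure IsEar {V : Type*} (H : SimpleGraph V) (σ : V → V) (zs : List V) (a : V) (L : List V)
    (a' : V) : Prop where
  left : a ∈ zs
  right : a' ∈ zs
  ne : a ≠ a'
  paired : Paired σ L
  nodup : L.Nodup
  disj : ∀ x ∈ L, x ∉ zs
  pth : Pth H.Adj a L a'

/-- A path `a :: T` starting in `zs`, with a blossom `β :: B` at its end `β`. -/
structure IsLollipop {V : Type*} (H : SimpleGraph V) (σ : V → V) (zs : List V) (a : V)
    (T B : List V) (β : V) : Prop where
  root : a ∈ zs
  pairedT : Paired σ T
  pairedB : Paired σ B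
  nodup : (T ++ B).Nodup
  disj : ∀ x ∈ T ++ B, x ∉ zs
  chain : (a :: T).IsChain H.Adj
  last : (a :: T).getLast? = some β
  pth : Pth H.Adj β B β

/-- `L` lists the vertices outside `zs` of an ear or a lollipop, attached to `zs` at the vertices
of `E`, which have colour `c`. -/
inductive Att {V : Type*} (H : SimpleGraph V) (σ : V → V) (χ : V → Bool) (zs : List V)
    (c : Bool) : List V → List V → Prop
  | ear {a a' : V} {L : List V} : IsEar H σ zs a L a' → χ a = c → χ a' = c → Att H σ χ zs c [a, a'] L
  | lollipop {a β : V} {T B : List V} : IsLollipop H σ zs a T B β → χ a = c →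
      Att H σ χ zs c [a] (T ++ B)

variable {V : Type*} {H : SimpleGraph V} {σ : V → V} {χ : V → Bool} {zs : List V} {v : V} {c : Bool}

/-- Goodness is independent of the pairing: `σ` and `τ` have the same tight sets, and such a set
containing `τ v`, a neighbour of `v`, also contains `σ v`. -/
theorem Good.not_mem [Finite V] (h : Good H v) {τ : V → V} (hτ : IsPairing H τ) {S : Set V}
    (hS : IsTight H τ S) : v ∉ S ∧ τ v ∉ S := by
  obtain ⟨σ, hσ, h⟩ := h
  have hS' : IsTight H σ S := (isTight_iff hσ).2 ((isTight_iff hτ).1 hS)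
  exact ⟨(h S hS').1, fun hv => (h S hS').2 (hS'.2 _ hv v (hτ.2 v).symm)⟩

theorem CAdj.symm {x y : V} (h : CAdj H χ x y) : CAdj H χ y x := ⟨h.1.symm, h.2.symm⟩

theorem Pth.crev {x y : V} {l : List V} (h : Pth (CAdj H χ) x l y) :
    Pth (CAdj H χ) y l.reverse x := h.reverse fun _ _ => CAdj.symm

theorem Pth.adj {x y : V} {l : List V} (h : Pth (CAdj H χ) x l y) : Pth H.Adj x l y :=
  h.mono fun _ _ h => h.1

theorem Pth.arev {x y : V} {l : List V} (h : Pth H.Adj x l y) : Pth H.Adj y l.reverse x :=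
  h.reverse fun _ _ h => h.symm

theorem Pth.ceven {x y : V} {l : List V} (h : Pth (CAdj H χ) x l y) :
    Even l.length ↔ χ x ≠ χ y := h.even_iff fun _ _ h => h.2

theorem Frame.arcs (hF : Frame H σ χ zs v) {a b : V} (ha : a ∈ zs) (hb : b ∈ zs) (hab : a ≠ b) :
    ∃ X Y, (a :: X ++ b :: Y).Perm zs ∧ Pth (CAdj H χ) a X b ∧ Pth (CAdj H χ) b Y a := by
  obtain ⟨t, ht, hp⟩ := hF.cyc a ha
  have : b ∈ t := by
    have := ht.mem_iff.2 hb
    simp only [List.mem_cons] at this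
    exact this.resolve_left hab.symm
  obtain ⟨X, Y, rfl⟩ := List.append_of_mem this
  exact ⟨X, Y, by simpa using ht, pth_append_cons.1 hp⟩

/-- A closed walk may be started anywhere. -/
theorem exists_pth_of_mem {R : V → V → Prop} {x : V} {t : List V} (h : Pth R x t x) {a : V}
    (ha : a ∈ x :: t) : ∃ t', (a :: t').Perm (x :: t) ∧ Pth R a t' a := by
  rcases List.mem_cons.1 ha with rfl | ha
  · exact ⟨t, .refl _, h⟩
  · obtain ⟨X, Y, rfl⟩ := List.append_of_mem ha
    have := pth_append_cons.1 h
    refine ⟨Y ++ x :: X, ?_, pth_append_cons.2 this.symm⟩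
    classical
    rw [List.perm_iff_count]
    intro z
    simp only [List.count_append, List.count_cons]
    omega

theorem IsEar.symm (hσ : ∀ x, σ (σ x) = x) {a a' : V} {L : List V} (h : IsEar H σ zs a L a') :
    IsEar H σ zs a' L.reverse a :=
  ⟨h.right, h.left, h.ne.symm, h.paired.reverse hσ, List.nodup_reverse.2 h.nodup,
    fun x hx => h.disj x (List.mem_reverse.1 hx), h.pth.arev⟩

theorem Att.sub {E L : List V} (h : Att H σ χ zs c E L) : ∀ a ∈ E, a ∈ zs ∧ χ a = c := by
  cases h with
  | ear h h1 h2 => simp [h.left, h.right, h1, h2]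
  | lollipop h h1 => simp [h.root, h1]

theorem Att.paired {E L : List V} (h : Att H σ χ zs c E L) : Paired σ L := by
  cases h with
  | ear h => exact h.paired
  | lollipop h => exact h.pairedT.append h.pairedB

theorem Att.disj {E L : List V} (h : Att H σ χ zs c E L) : ∀ x ∈ L, x ∉ zs := by
  cases h with
  | ear h => exact h.disj
  | lollipop h => exact h.disj

theorem Att.nodup {E L : List V} (h : Att H σ χ zs c E L) : L.Nodup := by
  cases h with
  | ear h => exact h.nodup
  | lollipop h => exact h.nodup

theorem IsLollipop.chain_append {a β : V} {T B : List V} (h : IsLollipop H σ zs a T B β) :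
    (a :: (T ++ B)).IsChain H.Adj := by
  rw [← List.cons_append]
  refine List.isChain_append.2 ⟨h.chain, h.pth.inner, fun x hx y hy => ?_⟩
  rw [h.last] at hx
  obtain rfl : x = β := by simpa using hx.symm
  exact List.isChain_cons.1 h.pth.left |>.1 y hy

/-- From every root, an attachment can be traversed completely. -/
theorem Att.exists_chain (hσ : ∀ x, σ (σ x) = x) {E L : List V} (h : Att H σ χ zs c E L) {b : V}
    (hb : b ∈ E) : ∃ L', L'.Perm L ∧ Paired σ L' ∧ (b :: L').IsChain H.Adj := by
  cases h with
  | ear h =>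
    simp only [List.mem_cons, List.not_mem_nil, or_false] at hb
    rcases hb with rfl | rfl
    · exact ⟨_, .refl _, h.paired, h.pth.left⟩
    · exact ⟨_, List.reverse_perm _, (h.symm hσ).paired, (h.symm hσ).pth.left⟩
  | lollipop h =>
    obtain rfl : b = _ := by simpa using hb
    exact ⟨_, .refl _, h.pairedT.append h.pairedB, h.chain_append⟩

/-! ### Existence of attachments of each colour -/

section Existence

/-- Insert before every entry its partner. -/
def prs (σ : V → V) (m : List V) : List V := m.flatMap fun x => [σ x, x]

theorem paired_prs (hσ : ∀ x, σ (σ x) = x) (m : List V) : Paired σ (prs σ m) := by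
  induction m with
  | nil => exact .nil
  | cons x m ih =>
    have := Paired.cons (σ x) ih
    rw [hσ] at this
    simpa [prs] using this

theorem prs_append (m n : List V) : prs σ (m ++ n) = prs σ m ++ prs σ n := by simp [prs]

theorem mem_prs (hσ : ∀ x, σ (σ x) = x) {m : List V} {x : V} :
    x ∈ prs σ m ↔ x ∈ m ∨ σ x ∈ m := by
  simp only [prs, List.mem_flatMap, List.mem_cons, List.not_mem_nil, or_false]
  constructor
  · rintro ⟨y, hy, rfl | rfl⟩
    · right; rwa [hσ]
    · exact .inl hy
  · rintro (h | h)
    · exact ⟨x, h, .inr rfl⟩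
    · exact ⟨_, h, .inl (hσ x).symm⟩

theorem nodup_prs (hσ : ∀ x, σ (σ x) = x) {m : List V} (hm : m.Nodup)
    (h : ∀ x ∈ m, σ x ∉ m) : (prs σ m).Nodup := by
  induction m with
  | nil => simp [prs]
  | cons x m ih =>
    have h1 : (prs σ m).Nodup := ih (List.nodup_cons.1 hm).2 fun y hy hy' =>
      h y (by simp [hy]) (by simp [hy'])
    have h2 : x ∉ prs σ m := by
      rw [mem_prs hσ, not_or]
      exact ⟨(List.nodup_cons.1 hm).1, fun h' => h x (by simp) (by simp [h'])⟩
    have h3 : σ x ∉ prs σ m := by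
      rw [mem_prs hσ, not_or, hσ]
      exact ⟨fun h' => h x (by simp) (by simp [h']), (List.nodup_cons.1 hm).1⟩
    have h4 : σ x ≠ x := fun h' => h x (by simp) (by simp [h'])
    simp only [prs, List.flatMap_cons] at *
    simp [h1, h2, h3, h4]

theorem pth_prs (hadj : ∀ x, H.Adj x (σ x)) {x w : V} {m : List V}
    (h : Pth (fun x y => H.Adj x (σ y)) x m w) : Pth H.Adj x (prs σ m) (σ w) := by
  induction m generalizing x with
  | nil =>
    have : H.Adj x (σ w) := (pth_nil (R := fun x y => H.Adj x (σ y))).1 h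
    exact pth_nil.2 this
  | cons y m ih =>
    have h' := pth_cons.1 h
    have : prs σ (y :: m) = σ y :: y :: prs σ m := by simp [prs]
    rw [this, pth_cons, pth_cons]
    exact ⟨h'.1, (hadj y).symm, ih h'.2⟩

/-- A conflict means that the walk crosses some pair in both directions; stopping at the first one
keeps the earlier part simple after partners are inserted. -/
theorem exists_first_conflict (hσ : ∀ x, σ (σ x) = x) (hne : ∀ x, σ x ≠ x) (m : List V) :
    (∀ x ∈ m, σ x ∉ m) ∨
      ∃ m₁ y m₂, m = m₁ ++ y :: m₂ ∧ σ y ∈ m₁ ∧ ∀ x ∈ m₁, σ x ∉ m₁ := by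
  induction m using List.reverseRecOn with
  | nil => simp
  | append_singleton m y ih =>
    rcases ih with ih | ⟨m₁, z, m₂, rfl, h1, h2⟩
    · by_cases hy : σ y ∈ m
      · exact .inr ⟨m, y, [], by simp, hy, ih⟩
      · left
        intro x hx
        simp only [List.mem_append, List.mem_singleton, not_or] at hx ⊢
        rcases hx with hx | rfl
        · refine ⟨ih x hx, ?_⟩
          rintro rfl
          exact hy (by rwa [hσ])
        · exact ⟨hy, hne x⟩
    · exact .inr ⟨m₁, z, m₂ ++ [y], by simp, h1, h2⟩

theorem exists_repetition {m : List V} (hm : ¬ m.Nodup) :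
    ∃ x l₁ l₂ l₃, m = l₁ ++ x :: l₂ ++ x :: l₃ := by
  induction m with
  | nil => simp at hm
  | cons y m ih =>
    by_cases hy : y ∈ m
    · obtain ⟨s, t, rfl⟩ := List.append_of_mem hy
      exact ⟨y, [], s, t, by simp⟩
    · have : ¬ m.Nodup := fun h => hm (List.nodup_cons.2 ⟨hy, h⟩)
      obtain ⟨x, l₁, l₂, l₃, rfl⟩ := ih this
      exact ⟨x, y :: l₁, l₂, l₃, by simp⟩

/-- If some closed set generated from one colour class is not independent, a shortest alternating
walk back to the frame yields an attachment. -/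
theorem att_of_pth (hσ : IsPairing H σ) {a w : V} {m : List V} (ha : a ∈ zs)
    (hinv : ∀ z ∈ zs, σ z ∈ zs) (hflip : ∀ z ∈ zs, χ (σ z) ≠ χ z)
    (hac : χ a = c) (hw : w ∈ zs) (hwc : χ w ≠ c) (hm : m.Nodup) (hmz : ∀ x ∈ m, x ∉ zs)
    (h : Pth (fun x y => H.Adj x (σ y)) a m w) : ∃ E L, Att H σ χ zs c E L := by
  have hmz' : ∀ x, x ∈ m ∨ σ x ∈ m → x ∉ zs := by
    rintro x (hx | hx) hxz
    · exact hmz x hx hxz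
    · exact hmz _ hx (hinv _ hxz)
  have hwc' : χ (σ w) = c := by
    have := hflip w hw
    revert this hwc
    cases χ w <;> cases χ (σ w) <;> cases c <;> simp
  rcases exists_first_conflict hσ.1 (fun x => (hσ.2 x).ne') m with hcon | ⟨m₁, y, m₂, rfl, hy, hcon⟩
  · by_cases haw : a = σ w
    · refine ⟨_, _, .lollipop (T := []) (B := prs σ m) (β := a) ⟨ha, .nil, paired_prs hσ.1 m,
        by simpa using nodup_prs hσ.1 hm hcon, ?_, by simp, by simp, ?_⟩ hac⟩
      · intro x hx
        exact hmz' x ((mem_prs hσ.1).1 (by simpa using hx))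
      · have := pth_prs hσ.2 h
        rwa [← haw] at this
    · exact ⟨_, _, .ear ⟨ha, hinv _ hw, haw, paired_prs hσ.1 m, nodup_prs hσ.1 hm hcon,
        fun x hx => hmz' x ((mem_prs hσ.1).1 hx), pth_prs hσ.2 h⟩ hac hwc'⟩
  -- The step towards `y` re-enters the visited vertex `σ y`. The closed part is a blossom based
  -- there, and the stem ends with the pair `y, σ y`.
  · obtain ⟨n₁, n₂, rfl⟩ := List.append_of_mem hy
    have h1 := pth_append_cons.1 (pth_append_cons.1 h).1
    have hT := pth_prs hσ.2 h1.1
    rw [hσ.1] at hT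
    have heq : prs σ (n₁ ++ [σ y]) = prs σ n₁ ++ [y, σ y] := by simp [prs, hσ.1]
    have heq' : prs σ (n₁ ++ [σ y]) ++ prs σ n₂ = prs σ (n₁ ++ σ y :: n₂) := by
      rw [← prs_append]; simp
    have hchain : (a :: prs σ (n₁ ++ [σ y])).IsChain H.Adj := by
      have : Pth H.Adj a (prs σ n₁ ++ y :: []) (σ y) := pth_append_cons.2 ⟨hT, pth_nil.2 (hσ.2 y)⟩
      rw [heq]
      simpa [Pth] using this
    refine ⟨_, _, .lollipop (T := prs σ (n₁ ++ [σ y])) (B := prs σ n₂) (β := σ y) ⟨ha,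
      paired_prs hσ.1 _, paired_prs hσ.1 _, ?_, ?_, hchain, ?_, pth_prs hσ.2 h1.2⟩ hac⟩
    · rw [heq']
      exact nodup_prs hσ.1 (List.nodup_append.1 hm).1 hcon
    · intro x hx
      rw [heq', mem_prs hσ.1] at hx
      exact hmz' x (hx.imp (fun h => List.mem_append_left _ h) fun h => List.mem_append_left _ h)
    · rw [heq]
      simp [List.getLast?_cons]

/-- The set reachable from colour `c` contains `v` or `σ v`, so it is not tight. It satisfies the
second tightness condition by construction, hence contains an edge, and joining a walk to one end
with the reversal of a walk to the other returns to the frame at the opposite colour. A shortest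
such walk is simple and meets the frame only at its ends. -/
theorem Frame.exists_att [Finite V] (hF : Frame H σ χ zs v) (hσ : IsPairing H σ) (hG : Good H v)
    (c : Bool) : ∃ E L, Att H σ χ zs c E L := by
  set r : V → V → Prop := fun x y => H.Adj x (σ y) with hr
  have hflip : ∀ z ∈ zs, χ (σ z) = c ↔ χ z ≠ c := fun z hz => by
    have := hF.flip z hz
    revert this
    cases χ z <;> cases χ (σ z) <;> cases c <;> simp
  have hskew : ∀ x y, Relation.ReflTransGen r x y → Relation.ReflTransGen r (σ y) (σ x) := by
    intro x y h
    induction h with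
    | refl => exact .refl
    | tail _ h ih =>
      refine .head ?_ ih
      simp only [hr, hσ.1] at h ⊢
      exact h.symm
  have hpath : ∃ a w, a ∈ zs ∧ χ a = c ∧ w ∈ zs ∧ χ w ≠ c ∧ Relation.ReflTransGen r a w := by
    by_contra! hno
    have hT : IsTight H σ {y | ∃ x ∈ zs, χ x = c ∧ Relation.ReflTransGen r x y} := by
      constructor
      · rintro x ⟨p, hp, hpc, hpx⟩ y ⟨q, hq, hqc, hqy⟩ hxy
        refine hno p (σ q) hp hpc (hF.inv q hq) ?_ ((hpx.tail ?_).trans (hskew _ _ hqy))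
        · rw [Ne, hflip q hq]; simp [hqc]
        · simpa [hr, hσ.1] using hxy
      · rintro x ⟨p, hp, hpc, hpx⟩ y hxy
        exact ⟨p, hp, hpc, hpx.tail (by simpa [hr, hσ.1] using hxy)⟩
    have := hG.not_mem hσ hT
    by_cases hv : χ v = c
    · exact this.1 ⟨v, hF.mem, hv, .refl⟩
    · exact this.2 ⟨σ v, hF.inv v hF.mem, (hflip v hF.mem).2 hv, .refl⟩
  have hlist : ∃ n a m w, m.length = n ∧ a ∈ zs ∧ χ a = c ∧ w ∈ zs ∧ χ w ≠ c ∧ Pth r a m w := by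
    obtain ⟨a, w, ha, hac, hw, hwc, h⟩ := hpath
    obtain ⟨l, hl, hlast⟩ := List.exists_isChain_cons_of_relationReflTransGen h
    rcases List.eq_nil_or_concat l with rfl | ⟨m, z, rfl⟩
    · simp at hlast; subst hlast; exact absurd hac hwc
    · simp at hlast; subst hlast
      exact ⟨_, a, m, z, rfl, ha, hac, hw, hwc, by simpa [Pth] using hl⟩
  classical
  obtain ⟨a, m, w, hmn, ha, hac, hw, hwc, hp⟩ := Nat.find_spec hlist
  have hmin : ∀ a' m' w', a' ∈ zs → χ a' = c → w' ∈ zs → χ w' ≠ c → Pth r a' m' w' →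
      m.length ≤ m'.length := by
    intro a' m' w' h1 h2 h3 h4 h5
    by_contra! hlt
    exact Nat.find_min hlist (hmn ▸ hlt) ⟨a', m', w', rfl, h1, h2, h3, h4, h5⟩
  refine att_of_pth hσ ha hF.inv hF.flip hac hw hwc ?_ ?_ hp
  · by_contra hnd
    obtain ⟨x, l₁, l₂, l₃, rfl⟩ := exists_repetition hnd
    have h1 := pth_append_cons.1 hp
    have h2 := pth_append_cons.1 h1.1
    have := hmin a _ w ha hac hw hwc (pth_append_cons.2 ⟨h2.1, h1.2⟩)
    simp at this
    omega
  · intro x hx hxz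
    obtain ⟨l₁, l₂, rfl⟩ := List.append_of_mem hx
    have h1 := pth_append_cons.1 hp
    by_cases hxc : χ x = c
    · have := hmin x _ w hxz hxc hw hwc h1.2
      simp at this
      omega
    · have := hmin a _ x ha hac hxz hxc h1.1
      simp at this

end Existence

end SterboulDeming

/-! ### Posies from a frame and disjoint attachments -/

namespace SterboulDeming

/-- `L` is a union of pairs lying outside `zs`. -/
structure Outer {V : Type*} (σ : V → V) (zs L : List V) : Prop where
  paired : Paired σ L
  nodup : L.Nodup
  disj : ∀ x ∈ L, x ∉ zs

variable {V : Type*} {H : SimpleGraph V} {σ : V → V} {χ : V → Bool} {zs : List V} {v : V} {c : Bool}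

theorem Att.outer {E L : List V} (h : Att H σ χ zs c E L) : Outer σ zs L :=
  ⟨h.paired, h.nodup, h.disj⟩

theorem IsEar.outer {a a' : V} {L : List V} (h : IsEar H σ zs a L a') : Outer σ zs L :=
  ⟨h.paired, h.nodup, h.disj⟩

theorem IsLollipop.outer {a β : V} {T B : List V} (h : IsLollipop H σ zs a T B β) :
    Outer σ zs (T ++ B) :=
  ⟨h.pairedT.append h.pairedB, h.nodup, h.disj⟩

/-- Common form of the configurations below: the frame and two disjoint outer lists are distributed
over the pieces of a posy and a discarded arc `X`. As `v` is on the frame, it suffices to keep it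
off `X`. -/
theorem Frame.hasPosy (hF : Frame H σ χ zs v) (hσ : IsPairing H σ) {L L' : List V}
    (hL : Outer σ zs L) (hL' : Outer σ zs L') (hLL : ∀ x ∈ L', x ∉ L)
    {P A₁ B₁ A₂ B₂ Q X : List V} {b₁ b₂ : V}
    (hperm : (P ++ A₁ ++ B₁ ++ A₂ ++ B₂ ++ Q ++ X).Perm (zs ++ L ++ L'))
    (heven : Even P.length ∧ Even A₁.length ∧ Even B₁.length ∧ Even A₂.length ∧ Even B₂.length ∧
      Even Q.length ∧ Even X.length)
    (hP : P.IsChain H.Adj) (hhead : P.head? = some b₁) (hlast : P.getLast? = some b₂)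
    (h₁ : Pth H.Adj b₁ (A₁ ++ Q ++ B₁) b₁) (h₂ : Pth H.Adj b₂ (A₂ ++ Q ++ B₂) b₂)
    (hX : X.IsChain H.Adj) (hv : v ∉ X) : HasPosy H v := by
  refine hasPosy_of_lists hσ hperm ?_ ?_ heven hP hhead hlast h₁ h₂ hX ?_
  · rw [List.nodup_append', List.nodup_append']
    refine ⟨⟨hF.nodup, hL.nodup, fun x hx hx' => hL.disj x hx' hx⟩, hL'.nodup, fun x hx hx' => ?_⟩
    rcases List.mem_append.1 hx with hx | hx
    · exact hL'.disj x hx' hx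
    · exact hLL x hx' hx
  · intro x hx
    simp only [List.mem_append] at hx ⊢
    rcases hx with (hx | hx) | hx
    · exact .inl (.inl (hF.inv x hx))
    · exact .inl (.inr (hL.paired.mem hσ.1 hx))
    · exact .inr (hL'.paired.mem hσ.1 hx)
  · have : v ∈ P ++ A₁ ++ B₁ ++ A₂ ++ B₂ ++ Q ++ X := hperm.mem_iff.2 (by simp [hF.mem])
    exact (List.mem_append.1 this).resolve_right hv

theorem even_length_of_ne {a b : V} {X : List V} (h : Pth (CAdj H χ) a X b) (hab : χ a ≠ χ b) :
    Even X.length := h.ceven.2 hab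

theorem odd_length_of_eq {a b : V} {X : List V} (h : Pth (CAdj H χ) a X b) (hab : χ a = χ b) :
    ¬ Even X.length := fun h' => h.ceven.1 h' hab

theorem IsLollipop.pth_reverse {a β x : V} {T B L : List V} (h : IsLollipop H σ zs a T B β)
    (hL : Pth H.Adj x L β) : Pth H.Adj x (L ++ T.reverse) a := by
  rcases List.eq_nil_or_concat T with rfl | ⟨T', z, rfl⟩
  · have := h.last
    simp only [List.getLast?_singleton, Option.some.injEq] at this
    simpa [this] using hL
  · have h1 := h.last
    simp only [List.concat_eq_append, ← List.cons_append, List.getLast?_append,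
      List.getLast?_singleton, Option.some_or, Option.some.injEq] at h1
    subst h1
    have h2 : Pth H.Adj a T' z := by simpa [Pth] using h.chain
    simpa using pth_append_cons.2 ⟨hL, h2.arev⟩

section Configurations

variable {a b : V} {X₁ X₂ X₃ X₄ : List V}

/-- A path from `b` that enters the stem of a lollipop rooted at `a`, on its way to the blossom,
closes a second blossom. -/
theorem Frame.hasPosy_of_stem (hF : Frame H σ χ zs v) (hσ : IsPairing H σ)
    (hz : (a :: X₁ ++ b :: X₂).Perm zs) (h₁ : Pth (CAdj H χ) a X₁ b) (h₂ : Pth (CAdj H χ) b X₂ a)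
    (hab : χ a ≠ χ b) (hv : v ∉ X₂) {T₁ T₂ B L : List V} {y β : V}
    (hT₁ : Paired σ T₁) (hT₂ : Paired σ T₂)
    (hl : IsLollipop H σ zs a (T₁ ++ [y, σ y] ++ T₂) B β) (hL : Outer σ zs L)
    (hd : ∀ x ∈ L, x ∉ T₁ ++ [y, σ y] ++ T₂ ++ B) (hp : Pth H.Adj b L y) : HasPosy H v := by
  have hc : Pth H.Adj a T₁ y ∧ (y :: σ y :: T₂).IsChain H.Adj := by
    have := hl.chain
    simp only [List.append_assoc, List.cons_append, List.nil_append] at this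
    rw [← List.cons_append, List.isChain_split] at this
    exact this
  -- The new blossom, based at `y`, descends the stem to `a`, follows the arc to `b` and returns
  -- through `L`. The upper stem joins it to the old blossom.
  refine hF.hasPosy hσ hl.outer hL hd (P := y :: σ y :: T₂) (A₁ := T₁.reverse ++ a :: X₁ ++ b :: L)
    (B₁ := []) (A₂ := B) (B₂ := []) (Q := []) (X := X₂) (b₁ := y) (b₂ := β) ?_ ?_ hc.2 rfl ?_ ?_ ?_
    h₂.adj.inner hv
  · classical
    rw [List.perm_iff_count]
    intro z
    have := hz.count_eq z
    simp only [List.count_append, List.count_cons, List.count_reverse, List.count_nil] at this ⊢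
    omega
  · have e1 := hT₁.even
    have e2 := hT₂.even
    have e3 := hl.pairedB.even
    have e4 := hL.paired.even
    have e5 := even_length_of_ne h₁ hab
    have e6 := even_length_of_ne h₂ hab.symm
    simp [*, parity_simps]
  · have := hl.last
    simpa [List.getLast?_cons, List.getLast?_append] using this
  · simp only [List.append_nil, List.append_assoc, List.cons_append]
    exact pth_append_cons.2 ⟨hc.1.arev, pth_append_cons.2 ⟨h₁.adj, hp⟩⟩
  · simpa using hl.pth

/-- A barbell: both stems and the arc `X₁` join the two blossoms. -/
theorem Frame.hasPosy_of_lollipops (hF : Frame H σ χ zs v) (hσ : IsPairing H σ)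
    (hz : (a :: X₁ ++ b :: X₂).Perm zs) (h₁ : Pth (CAdj H χ) a X₁ b) (h₂ : Pth (CAdj H χ) b X₂ a)
    (hab : χ a ≠ χ b) (hv : v ∉ X₂) {T B T' B' : List V} {β β' : V}
    (hl : IsLollipop H σ zs a T B β) (hl' : IsLollipop H σ zs b T' B' β')
    (hd : ∀ x ∈ T' ++ B', x ∉ T ++ B) : HasPosy H v := by
  refine hF.hasPosy hσ hl.outer hl'.outer hd (P := (a :: T).reverse ++ (X₁ ++ b :: T')) (A₁ := B)
    (B₁ := []) (A₂ := B') (B₂ := []) (Q := []) (X := X₂) (b₁ := β) (b₂ := β') ?_ ?_ ?_ ?_ ?_ ?_ ?_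
    h₂.adj.inner hv
  · classical
    rw [List.perm_iff_count]
    intro z
    have := hz.count_eq z
    simp only [List.count_append, List.count_cons, List.count_reverse, List.count_nil] at this ⊢
    omega
  · have e1 := hl.pairedT.even
    have e2 := hl'.pairedT.even
    have e3 := hl.pairedB.even
    have e4 := hl'.pairedB.even
    have e5 := even_length_of_ne h₁ hab
    have e6 := even_length_of_ne h₂ hab.symm
    simp [*, parity_simps]
  · rw [List.reverse_cons, List.append_assoc, List.singleton_append, List.isChain_split]
    refine ⟨?_, List.isChain_split.2 ⟨h₁.adj, hl'.chain⟩⟩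
    simpa using isChain_reverse_of_symm (fun _ _ h => h.symm) hl.chain
  · rw [List.head?_append, List.head?_reverse, hl.last]; rfl
  · rw [List.getLast?_append, List.getLast?_append, hl'.last]; rfl
  · simpa using hl.pth
  · simpa using hl'.pth

/-- A barbell: the ear closes an odd cycle with the arc `X₁`, whose order is odd because `a` and
`a'` have the same colour. -/
theorem Frame.hasPosy_of_ear_lollipop (hF : Frame H σ χ zs v) (hσ : IsPairing H σ) {a' : V}
    (hz : (a :: X₁ ++ a' :: X₂ ++ b :: X₃).Perm zs) (h₁ : Pth (CAdj H χ) a X₁ a')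
    (h₂ : Pth (CAdj H χ) a' X₂ b) (h₃ : Pth (CAdj H χ) b X₃ a)
    (haa : χ a = χ a') (hab : χ a ≠ χ b) (hv : v ∉ X₃) {L T B : List V} {β : V}
    (he : IsEar H σ zs a L a') (hl : IsLollipop H σ zs b T B β)
    (hd : ∀ x ∈ T ++ B, x ∉ L) : HasPosy H v := by
  refine hF.hasPosy hσ he.outer hl.outer hd (P := a' :: X₂ ++ b :: T) (A₁ := X₁.reverse ++ a :: L)
    (B₁ := []) (A₂ := B) (B₂ := []) (Q := []) (X := X₃) (b₁ := a') (b₂ := β) ?_ ?_ ?_ rfl ?_ ?_ ?_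
    h₃.adj.inner hv
  · classical
    rw [List.perm_iff_count]
    intro z
    have := hz.count_eq z
    simp only [List.count_append, List.count_cons, List.count_reverse, List.count_nil] at this ⊢
    omega
  · have e1 := hl.pairedT.even
    have e2 := hl.pairedB.even
    have e3 := he.paired.even
    have e4 := odd_length_of_eq h₁ haa
    have e5 := even_length_of_ne h₂ (haa ▸ hab)
    have e6 := even_length_of_ne h₃ hab.symm
    simp_all [parity_simps]
  · rw [List.isChain_split]
    exact ⟨h₂.adj, hl.chain⟩
  · rw [List.getLast?_append, hl.last]; rfl
  · simp only [List.append_nil]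
    exact pth_append_cons.2 ⟨h₁.adj.arev, he.pth⟩
  · simpa using hl.pth

/-- A barbell: the ears do not cross, and each closes a blossom with the arc between its own ends.
-/
theorem Frame.hasPosy_of_nested_ears (hF : Frame H σ χ zs v) (hσ : IsPairing H σ) {a' b' : V}
    (hz : (a :: X₁ ++ a' :: X₂ ++ b' :: X₃ ++ b :: X₄).Perm zs) (h₁ : Pth (CAdj H χ) a X₁ a')
    (h₂ : Pth (CAdj H χ) a' X₂ b') (h₃ : Pth (CAdj H χ) b' X₃ b) (h₄ : Pth (CAdj H χ) b X₄ a)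
    (haa : χ a = χ a') (hbb : χ b = χ b') (hab : χ a ≠ χ b) (hv : v ∉ X₄) {L L' : List V}
    (he : IsEar H σ zs a L a') (he' : IsEar H σ zs b L' b')
    (hd : ∀ x ∈ L', x ∉ L) : HasPosy H v := by
  refine hF.hasPosy hσ he.outer he'.outer hd (P := a' :: X₂ ++ [b']) (A₁ := X₁.reverse ++ a :: L)
    (B₁ := []) (A₂ := X₃ ++ b :: L') (B₂ := []) (Q := []) (X := X₄) (b₁ := a') (b₂ := b')
    ?_ ?_ h₂.adj rfl ?_ ?_ ?_ h₄.adj.inner hv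
  · classical
    rw [List.perm_iff_count]
    intro z
    have := hz.count_eq z
    simp only [List.count_append, List.count_cons, List.count_reverse, List.count_nil] at this ⊢
    omega
  · have e1 := he.paired.even
    have e2 := he'.paired.even
    have e4 := odd_length_of_eq h₁ haa
    have e5 := even_length_of_ne h₂ (haa ▸ hbb ▸ hab)
    have e6 := odd_length_of_eq h₃ hbb.symm
    have e7 := even_length_of_ne h₄ hab.symm
    simp_all [parity_simps]
  · rw [List.getLast?_append]; rfl
  · simp only [List.append_nil]
    exact pth_append_cons.2 ⟨h₁.adj.arev, he.pth⟩
  · simp only [List.append_nil]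
    exact pth_append_cons.2 ⟨h₃.adj, he'.pth⟩

/-- Crossing ears give a subdivided complete graph on four vertices: the blossoms share the arc from
`a'` to `b'`, and nothing is discarded. -/
theorem Frame.hasPosy_of_crossing_ears (hF : Frame H σ χ zs v) (hσ : IsPairing H σ) {a' b' : V}
    (hz : (a :: X₁ ++ b :: X₂ ++ a' :: X₃ ++ b' :: X₄).Perm zs) (h₁ : Pth (CAdj H χ) a X₁ b)
    (h₂ : Pth (CAdj H χ) b X₂ a') (h₃ : Pth (CAdj H χ) a' X₃ b') (h₄ : Pth (CAdj H χ) b' X₄ a)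
    (haa : χ a = χ a') (hbb : χ b = χ b') (hab : χ a ≠ χ b) {L L' : List V}
    (he : IsEar H σ zs a L a') (he' : IsEar H σ zs b' L' b)
    (hd : ∀ x ∈ L', x ∉ L) : HasPosy H v := by
  refine hF.hasPosy hσ he.outer he'.outer hd (P := a :: X₁ ++ [b]) (A₁ := L)
    (B₁ := X₄) (A₂ := X₂) (B₂ := L') (Q := a' :: X₃ ++ [b']) (X := []) (b₁ := a) (b₂ := b)
    ?_ ?_ h₁.adj rfl ?_ ?_ ?_ .nil (by simp)
  · classical
    rw [List.perm_iff_count]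
    intro z
    have := hz.count_eq z
    simp only [List.count_append, List.count_cons, List.count_nil] at this ⊢
    omega
  · have e1 := he.paired.even
    have e2 := he'.paired.even
    have e4 := even_length_of_ne h₁ hab
    have e5 := even_length_of_ne h₂ (haa ▸ hab.symm)
    have e6 := even_length_of_ne h₃ (haa ▸ hbb ▸ hab)
    have e7 := even_length_of_ne h₄ (hbb ▸ hab.symm)
    simp_all [parity_simps]
  · rw [List.getLast?_append]; rfl
  · simp only [List.append_assoc, List.cons_append, List.nil_append]
    exact pth_append_cons.2 ⟨he.pth, pth_append_cons.2 ⟨h₃.adj, h₄.adj⟩⟩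
  · simp only [List.append_assoc, List.cons_append, List.nil_append]
    exact pth_append_cons.2 ⟨h₂.adj, pth_append_cons.2 ⟨h₃.adj, he'.pth⟩⟩

end Configurations

end SterboulDeming

/-! ### Choosing the discarded arc; attachments that meet -/

namespace SterboulDeming

variable {V : Type*} {H : SimpleGraph V} {σ : V → V} {χ : V → Bool} {zs : List V} {v : V} {c : Bool}
variable {a b : V}

theorem perm_reverse_arcs {X Y : List V} (h : (a :: X ++ b :: Y).Perm zs) :
    (a :: Y.reverse ++ b :: X.reverse).Perm zs := by
  classical
  rw [List.perm_iff_count] at h ⊢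
  intro z
  have := h z
  simp only [List.count_append, List.count_cons, List.count_reverse] at this ⊢
  omega

theorem not_mem_arc (hn : zs.Nodup) {X Y : List V} (h : (a :: X ++ b :: Y).Perm zs) {x : V}
    (hx : x ∈ Y) : x ∉ X ∧ x ≠ a ∧ x ≠ b := by
  have := h.nodup_iff.2 hn
  rw [List.nodup_append'] at this
  obtain ⟨h1, h2, h3⟩ := this
  have h4 := List.disjoint_right.1 h3 (List.mem_cons_of_mem _ hx)
  simp only [List.mem_cons, not_or] at h4
  exact ⟨h4.2, h4.1, fun h => (List.nodup_cons.1 h2).1 (h ▸ hx)⟩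

theorem mem_arcs {X Y : List V} (h : (a :: X ++ b :: Y).Perm zs) {x : V} (hx : x ∈ zs)
    (hxa : x ≠ a) (hxb : x ≠ b) : x ∈ X ∨ x ∈ Y := by
  have := h.mem_iff.2 hx
  simpa [hxa, hxb] using this

theorem Frame.hasPosy_of_lollipops' (hF : Frame H σ χ zs v) (hσ : IsPairing H σ)
    (hab : χ a ≠ χ b) {T B T' B' : List V} {β β' : V}
    (hl : IsLollipop H σ zs a T B β) (hl' : IsLollipop H σ zs b T' B' β')
    (hd : ∀ x ∈ T' ++ B', x ∉ T ++ B) : HasPosy H v := by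
  obtain ⟨X, Y, hz, hX, hY⟩ := hF.arcs hl.root hl'.root (fun h => hab (h ▸ rfl))
  by_cases hv : v ∈ Y
  · exact hF.hasPosy_of_lollipops hσ (perm_reverse_arcs hz) hY.crev hX.crev hab
      (fun h => (not_mem_arc hF.nodup hz hv).1 (List.mem_reverse.1 h)) hl hl' hd
  · exact hF.hasPosy_of_lollipops hσ hz hX hY hab hv hl hl' hd

theorem Frame.hasPosy_of_ear_lollipop' (hF : Frame H σ χ zs v) (hσ : IsPairing H σ) {a' : V}
    (haa : χ a = χ a') (hab : χ a ≠ χ b) {L T B : List V} {β : V}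
    (he : IsEar H σ zs a L a') (hl : IsLollipop H σ zs b T B β)
    (hd : ∀ x ∈ T ++ B, x ∉ L) : HasPosy H v := by
  have key : ∀ X Y, (a :: X ++ a' :: Y).Perm zs → Pth (CAdj H χ) a X a' →
      Pth (CAdj H χ) a' Y a → b ∈ Y → HasPosy H v := by
    intro X Y hz hX hY hb
    obtain ⟨X₂, X₃, rfl⟩ := List.append_of_mem hb
    obtain ⟨h₂, h₃⟩ := pth_append_cons.1 hY
    have hz' : (a :: X ++ a' :: X₂ ++ b :: X₃).Perm zs := by simpa using hz
    -- If `v` would be discarded, exchanging the ends of the ear discards `X₂` instead.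
    by_cases hv : v ∈ X₃
    · refine hF.hasPosy_of_ear_lollipop hσ (a := a') (a' := a) (X₁ := X.reverse)
        (X₂ := X₃.reverse) (X₃ := X₂.reverse) ?_ hX.crev h₃.crev h₂.crev haa.symm (haa ▸ hab) ?_
        (he.symm hσ.1) hl (by simpa using hd)
      · classical
        rw [List.perm_iff_count] at hz' ⊢
        intro z
        have := hz' z
        simp only [List.count_append, List.count_cons, List.count_reverse] at this ⊢
        omega
      · have := (not_mem_arc (X := X ++ a' :: X₂) hF.nodup hz' hv).1
        simp only [List.mem_append, List.mem_cons, not_or] at this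
        simpa using this.2.2
    · exact hF.hasPosy_of_ear_lollipop hσ hz' hX h₂ h₃ haa hab hv he hl hd
  obtain ⟨X, Y, hz, hX, hY⟩ := hF.arcs he.left he.right he.ne
  have hba : b ≠ a := fun h => hab (h ▸ rfl)
  have hba' : b ≠ a' := fun h => hab (h ▸ haa)
  rcases mem_arcs hz hl.root hba hba' with hb | hb
  · exact key _ _ (perm_reverse_arcs hz) hY.crev hX.crev (List.mem_reverse.2 hb)
  · exact key _ _ hz hX hY hb

theorem Frame.hasPosy_of_ears (hF : Frame H σ χ zs v) (hσ : IsPairing H σ) {a' b' : V}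
    (haa : χ a = χ a') (hbb : χ b = χ b') (hab : χ a ≠ χ b) {L L' : List V}
    (he : IsEar H σ zs a L a') (he' : IsEar H σ zs b L' b')
    (hd : ∀ x ∈ L', x ∉ L) : HasPosy H v := by
  have nested : ∀ b b' L' X₁ X₂ X₃ X₄, χ b = χ b' → χ a ≠ χ b → IsEar H σ zs b L' b' →
      (∀ x ∈ L', x ∉ L) → (a :: X₁ ++ a' :: X₂ ++ b' :: X₃ ++ b :: X₄).Perm zs →
      Pth (CAdj H χ) a X₁ a' → Pth (CAdj H χ) a' X₂ b' → Pth (CAdj H χ) b' X₃ b →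
      Pth (CAdj H χ) b X₄ a → HasPosy H v := by
    intro b b' L' X₁ X₂ X₃ X₄ hbb hab he' hd hz h₁ h₂ h₃ h₄
    by_cases hv : v ∈ X₄
    · refine hF.hasPosy_of_nested_ears hσ (a := a') (a' := a) (b := b') (b' := b)
        (X₁ := X₁.reverse) (X₂ := X₄.reverse) (X₃ := X₃.reverse) (X₄ := X₂.reverse) ?_
        h₁.crev h₄.crev h₃.crev h₂.crev haa.symm hbb.symm (haa ▸ hbb ▸ hab) ?_
        (he.symm hσ.1) (he'.symm hσ.1) (by simpa using hd)
      · classical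
        rw [List.perm_iff_count] at hz ⊢
        intro z
        have := hz z
        simp only [List.count_append, List.count_cons, List.count_reverse] at this ⊢
        omega
      · have := (not_mem_arc (X := X₁ ++ a' :: X₂ ++ b' :: X₃) hF.nodup hz hv).1
        simp only [List.append_assoc, List.cons_append, List.mem_append, List.mem_cons,
          not_or] at this
        simpa using this.2.2.1
    · exact hF.hasPosy_of_nested_ears hσ hz h₁ h₂ h₃ h₄ haa hbb hab hv he he' hd
  have hd' : ∀ x ∈ L'.reverse, x ∉ L := by simpa using hd
  have key : ∀ X Y, (a :: X ++ a' :: Y).Perm zs → Pth (CAdj H χ) a X a' →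
      Pth (CAdj H χ) a' Y a → b ∈ Y → (b' ∈ X ∨ b' ∈ Y) → HasPosy H v := by
    intro X Y hz hX hY hb hb'
    obtain ⟨Y₁, Y₂, rfl⟩ := List.append_of_mem hb
    obtain ⟨h₂, h₃⟩ := pth_append_cons.1 hY
    simp only [List.mem_append, List.mem_cons, he'.ne.symm, false_or] at hb'
    -- The ears cross when their ends alternate on the cycle; otherwise they are nested, in one of
    -- two orders.
    rcases hb' with hb' | hb' | hb'
    · obtain ⟨X₁, X₂, rfl⟩ := List.append_of_mem hb'
      obtain ⟨h₀, h₁⟩ := pth_append_cons.1 hX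
      exact hF.hasPosy_of_crossing_ears hσ (by simpa using hz) h₀ h₁ h₂ h₃ haa hbb.symm
        (hbb ▸ hab) he he' hd
    · obtain ⟨Z₁, Z₂, rfl⟩ := List.append_of_mem hb'
      obtain ⟨h₀, h₁⟩ := pth_append_cons.1 h₂
      exact nested b b' L' X Z₁ Z₂ Y₂ hbb hab he' hd (by simpa using hz) hX h₀ h₁ h₃
    · obtain ⟨Z₁, Z₂, rfl⟩ := List.append_of_mem hb'
      obtain ⟨h₀, h₁⟩ := pth_append_cons.1 h₃
      exact nested b' b _ X Y₁ Z₁ Z₂ hbb.symm (hbb ▸ hab) (he'.symm hσ.1) hd'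
        (by simpa using hz) hX h₂ h₀ h₁
  obtain ⟨X, Y, hz, hX, hY⟩ := hF.arcs he.left he.right he.ne
  have hba : b ≠ a := fun h => hab (h ▸ rfl)
  have hba' : b ≠ a' := fun h => hab (h ▸ haa)
  have hb'a : b' ≠ a := fun h => hab (h ▸ hbb.symm)
  have hb'a' : b' ≠ a' := fun h => hab (haa.trans (h ▸ hbb.symm))
  have hb' := mem_arcs hz he'.right hb'a hb'a'
  rcases mem_arcs hz he'.left hba hba' with hb | hb
  · exact key _ _ (perm_reverse_arcs hz) hY.crev hX.crev (List.mem_reverse.2 hb)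
      (by simpa using hb'.symm)
  · exact key _ _ hz hX hY hb hb'

/-- Disjoint attachments of both colours complete the frame to a posy. -/
theorem Frame.hasPosy_of_disjoint (hF : Frame H σ χ zs v) (hσ : IsPairing H σ) {d : Bool}
    (hcd : c ≠ d) {E L E' L' : List V} (hA : Att H σ χ zs c E L) (hA' : Att H σ χ zs d E' L')
    (hd : ∀ x ∈ L', x ∉ L) : HasPosy H v := by
  cases hA with
  | ear h h1 h2 =>
    cases hA' with
    | ear h' h1' h2' =>
      exact hF.hasPosy_of_ears hσ (h1.trans h2.symm) (h1'.trans h2'.symm)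
        (by rwa [h1, h1']) h h' hd
    | lollipop h' h1' =>
      exact hF.hasPosy_of_ear_lollipop' hσ (h1.trans h2.symm) (by rwa [h1, h1']) h h' hd
  | lollipop h h1 =>
    cases hA' with
    | ear h' h1' h2' =>
      exact hF.hasPosy_of_ear_lollipop' hσ (h1'.trans h2'.symm) (by rw [h1, h1']; exact hcd.symm)
        h' h (fun x hx hx' => hd x hx' hx)
    | lollipop h' h1' =>
      exact hF.hasPosy_of_lollipops' hσ (by rwa [h1, h1']) h h' hd

/-- Splicing: follow `l` up to `L`, cross the pair met there, and continue inside `L` to its root.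
-/
theorem outer_of_hit {L l R R' : List V} {y : V} (hL : Outer σ zs L)
    (hl : Outer σ zs l) (hd : ∀ x ∈ l, x ∉ L) (hR : Paired σ R)
    (hp : (y :: σ y :: R ++ R').Perm L) (hb : Pth H.Adj b l y) (ha : Pth H.Adj (σ y) R a)
    (hadj : ∀ x, H.Adj x (σ x)) :
    ∃ J, J ≠ [] ∧ Outer σ zs J ∧ Pth H.Adj b J a := by
  have hsub : ∀ x ∈ y :: σ y :: R, x ∈ L := fun x hx =>
    hp.mem_iff.1 (List.mem_append_left _ hx)
  refine ⟨l ++ y :: σ y :: R, by simp, ⟨hl.paired.append (.cons y hR), ?_, ?_⟩, ?_⟩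
  · rw [List.nodup_append']
    exact ⟨hl.nodup, (List.nodup_append'.1 (hp.nodup_iff.2 hL.nodup)).1,
      fun x hx hx' => hd x hx (hsub x hx')⟩
  · intro x hx
    rcases List.mem_append.1 hx with hx | hx
    · exact hl.disj x hx
    · exact hL.disj x (hsub x hx)
  · exact pth_append_cons.2 ⟨hb, pth_cons.2 ⟨hadj y, ha⟩⟩

/-- A structure starting in the frame that meets an attachment of the other colour yields an
alternating path back to a root of that attachment, or a posy. -/
theorem Frame.exists_link (hF : Frame H σ χ zs v) (hσ : IsPairing H σ) {E L L' : List V}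
    (hA : Att H σ χ zs c E L) (hb : b ∈ zs) (hbc : χ b ≠ c) (hL' : Outer σ zs L')
    (hch : (b :: L').IsChain H.Adj) (hx : ∃ x ∈ L', x ∈ L) :
    HasPosy H v ∨ ∃ a ∈ E, ∃ J, J ≠ [] ∧ Outer σ zs J ∧ Pth H.Adj b J a := by
  have hlink : ∀ l y R R' a, Outer σ zs l → (∀ x ∈ l, x ∉ L) → Pth H.Adj b l y → a ∈ E →
      Paired σ R → (y :: σ y :: R ++ R').Perm L → Pth H.Adj (σ y) R a →
      ∃ a ∈ E, ∃ J, J ≠ [] ∧ Outer σ zs J ∧ Pth H.Adj b J a :=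
    fun l y R R' a hl hd hp ha hR hperm hR' =>
      ⟨a, ha, outer_of_hit hA.outer hl hd hR hperm hp hR' hσ.2⟩
  rcases hL'.paired.first (· ∈ L) (fun x hx => by simpa [hσ.1] using hA.paired.mem hσ.1 hx) with
    h | ⟨l, y, l₂, rfl, hl, -, hy, hd⟩
  · obtain ⟨x, hx, hx'⟩ := hx
    exact absurd hx' (h x hx)
  have hl' : Outer σ zs l := by
    refine ⟨hl, ?_, fun x hx => hL'.disj x (by simp [hx])⟩
    exact (List.nodup_append'.1 (List.nodup_append'.1 hL'.nodup).1).1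
  have hby : Pth H.Adj b l y := by
    simp only [List.append_assoc, List.cons_append, List.nil_append] at hch
    rw [← List.cons_append, List.isChain_split] at hch
    exact hch.1
  cases hA with
  | @ear a a' L h h1 h2 =>
    right
    obtain ⟨m₁, w, m₂, rfl, k₁, k₂, hyw⟩ := h.paired.split hy
    have hp := h.pth
    simp only [List.append_assoc, List.cons_append, List.nil_append] at hp
    obtain ⟨p1, p2⟩ := pth_append_cons.1 hp
    obtain ⟨-, p2⟩ := pth_cons.1 p2
    -- After crossing the pair, the ear is followed onwards, to whichever end lies in that
    -- direction.
    rcases hyw with rfl | rfl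
    · refine hlink l y m₂ m₁ a' hl' hd hby (by simp) k₂ ?_ p2
      simpa using List.perm_append_comm (l₁ := y :: σ y :: m₂) (l₂ := m₁)
    · refine hlink l _ m₁.reverse m₂ a hl' hd hby (by simp) (k₁.reverse hσ.1) ?_ ?_
      · classical
        rw [List.perm_iff_count]
        intro z
        simp only [hσ.1, List.count_append, List.count_cons, List.count_reverse, List.count_nil]
        omega
      · rw [hσ.1]; exact p1.arev
  | @lollipop a β T B h h1 =>
    rcases List.mem_append.1 hy with hy | hy
    · obtain ⟨m₁, w, m₂, rfl, k₁, k₂, hyw⟩ := h.pairedT.split hy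
      rcases hyw with rfl | rfl
      -- Here the partner of `y` is farther from the root, so crossing the pair does not lead down
      -- the stem; a second blossom closes at `y` instead.
      · left
        have hab : χ a ≠ χ b := by rw [h1]; exact hbc.symm
        obtain ⟨X, Y, hz, hX, hY⟩ := hF.arcs h.root hb (fun h => hab (h ▸ rfl))
        by_cases hv : v ∈ Y
        · exact hF.hasPosy_of_stem hσ (perm_reverse_arcs hz) hY.crev hX.crev hab
            (fun h => (not_mem_arc hF.nodup hz hv).1 (List.mem_reverse.1 h)) k₁ k₂ h hl' hd hby
        · exact hF.hasPosy_of_stem hσ hz hX hY hab hv k₁ k₂ h hl' hd hby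
      · right
        refine hlink l _ m₁.reverse (m₂ ++ B) a hl' hd hby (by simp) (k₁.reverse hσ.1) ?_ ?_
        · classical
          rw [List.perm_iff_count]
          intro z
          simp only [hσ.1, List.count_append, List.count_cons, List.count_reverse, List.count_nil]
          omega
        · rw [hσ.1]
          have := h.chain
          simp only [List.append_assoc, List.cons_append, List.nil_append] at this
          rw [← List.cons_append, List.isChain_split] at this
          exact Pth.arev this.1
    · right
      obtain ⟨m₁, w, m₂, rfl, k₁, k₂, hyw⟩ := h.pairedB.split hy
      have hp := h.pth
      simp only [List.append_assoc, List.cons_append, List.nil_append] at hp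
      obtain ⟨p1, p2⟩ := pth_append_cons.1 hp
      obtain ⟨-, p2⟩ := pth_cons.1 p2
      -- On the blossom both directions lead to the base, and from there down the stem to the root.
      rcases hyw with rfl | rfl
      · refine hlink l y (m₂ ++ T.reverse) m₁ a hl' hd hby (by simp)
          (k₂.append (h.pairedT.reverse hσ.1)) ?_ (h.pth_reverse p2)
        classical
        rw [List.perm_iff_count]
        intro z
        simp only [List.count_append, List.count_cons, List.count_reverse, List.count_nil]
        omega
      · refine hlink l _ (m₁.reverse ++ T.reverse) m₂ a hl' hd hby (by simp)
          ((k₁.reverse hσ.1).append (h.pairedT.reverse hσ.1)) ?_ ?_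
        · classical
          rw [List.perm_iff_count]
          intro z
          simp only [hσ.1, List.count_append, List.count_cons, List.count_reverse, List.count_nil]
          omega
        · rw [hσ.1]; exact h.pth_reverse p1.arev

end SterboulDeming

/-! ### Deleting an edge of the frame -/

namespace SterboulDeming

section Transfer

variable {V : Type*} {R R' : V → V → Prop} {D : List V}

theorem isChain_transfer (hR : ∀ x y, R x y → (x ∉ D ∨ y ∉ D) → R' x y) {x : V} {l : List V}
    (h : (x :: l).IsChain R) (hl : ∀ z ∈ l, z ∉ D) : (x :: l).IsChain R' := by
  induction l generalizing x with
  | nil => simp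
  | cons y l ih =>
    rw [List.isChain_cons_cons] at h ⊢
    exact ⟨hR _ _ h.1 (.inr (hl y (by simp))), ih h.2 fun z hz => hl z (by simp [hz])⟩

theorem pth_transfer (hR : ∀ x y, R x y → (x ∉ D ∨ y ∉ D) → R' x y) {x y : V} {l : List V}
    (h : Pth R x l y) (hl : ∀ z ∈ l, z ∉ D) (hnil : l = [] → R' x y) : Pth R' x l y := by
  rcases List.eq_nil_or_concat l with rfl | ⟨l, z, rfl⟩
  · exact pth_nil.2 (hnil rfl)
  · rw [List.concat_eq_append] at *
    obtain ⟨h1, h2⟩ := pth_append_cons.1 h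
    exact pth_append_cons.2 ⟨isChain_transfer hR h1 hl,
      pth_nil.2 (hR _ _ (pth_nil.1 h2) (.inl (hl z (by simp))))⟩

end Transfer

variable {V : Type*} {H H' : SimpleGraph V} {σ τ : V → V} {χ : V → Bool} {zs : List V} {v : V}
variable {c : Bool} {a b : V} {S : Set V}

/-- An attachment edge has an end off the frame or, for an ear consisting of one edge, ends of equal
colour; so deleting a two-coloured frame edge spares it. -/
theorem Att.transfer (hH : ∀ x y, H.Adj x y → (x ∉ zs ∨ y ∉ zs) → H'.Adj x y)
    (hχ : ∀ x y, H.Adj x y → χ x = χ y → H'.Adj x y) (hτ : ∀ x, x ∉ zs → τ x = σ x)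
    {E L : List V} (h : Att H σ χ zs c E L) : Att H' τ χ zs c E L := by
  cases h with
  | ear h h1 h2 =>
    refine .ear ⟨h.left, h.right, h.ne, h.paired.congr fun x hx => hτ x (h.disj x hx), h.nodup,
      h.disj, pth_transfer hH h.pth h.disj ?_⟩ h1 h2
    rintro rfl
    exact hχ _ _ (pth_nil.1 h.pth) (h1.trans h2.symm)
  | lollipop h h1 =>
    refine .lollipop ⟨h.root, h.pairedT.congr fun x hx => hτ x (h.disj x (by simp [hx])),
      h.pairedB.congr fun x hx => hτ x (h.disj x (by simp [hx])), h.nodup, h.disj,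
      isChain_transfer hH h.chain fun x hx => h.disj x (by simp [hx]), h.last,
      pth_transfer hH h.pth (fun x hx => h.disj x (by simp [hx])) ?_⟩ h1
    rintro rfl
    exact hχ _ _ (pth_nil.1 h.pth) rfl

/-- With all roots in `S`, an ear would carry `S` from one end to the partner of the other, and a
lollipop would carry it to the base of its blossom. -/
theorem IsTight.exists_root_not_mem (hσ : IsPairing H σ) (hS : IsTight H σ S) {E L : List V}
    (h : Att H σ χ zs c E L) : ∃ x ∈ E, x ∉ S := by
  by_contra! hE
  cases h with
  | ear h =>
    exact hS.partner_not_mem hσ (hE _ (by simp))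
      (hS.forward_pth h.paired h.pth (hE _ (by simp)))
  | lollipop h =>
    exact hS.base_not_mem hσ h.pairedB h.pth
      (hS.forward h.pairedT h.chain (hE _ (by simp)) h.last)

/-- Spreading reaches every second vertex, which under alternate colouring is the whole colour class
of `x` on the path. -/
theorem IsTight.mem_of_color (hS : IsTight H σ S) {x : V} {L : List V} (hL : Paired σ L)
    (hc : (x :: L).IsChain (CAdj H χ)) (hx : x ∈ S) {z : V} (hz : z ∈ L) (hzc : χ z = χ x) :
    z ∈ S := by
  induction hL generalizing x with
  | nil => simp at hz
  | @cons y l _ ih =>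
    rw [List.isChain_cons_cons, List.isChain_cons_cons] at hc
    have hcol : χ (σ y) = χ x := by
      have h1 := hc.1.2
      have h2 := hc.2.1.2
      revert h1 h2
      cases χ x <;> cases χ y <;> cases χ (σ y) <;> simp
    have hy : σ y ∈ S := hS.2 x hx y hc.1.1
    simp only [List.mem_cons] at hz
    rcases hz with rfl | rfl | hz
    · exact absurd hzc.symm hc.1.2
    · exact hy
    · exact ih hc.2.2 hy hz (hzc.trans hcol.symm)

/-- A tight set containing `a` spreads over the colour class of `a` on a frame which is cut
after `W`. -/
theorem IsTight.false_of_spread (hσ : IsPairing H σ) (hS : IsTight H σ S) {W Y J E L : List V}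
    (hW : (a :: W).IsChain (CAdj H χ)) (pW : Paired σ W)
    (hC : Pth (CAdj H χ) b Y a) (pC : Paired σ (b :: Y ++ [a])) (pJ : Paired σ J)
    (hJ : Pth H.Adj a J b) (hab : χ a ≠ χ b) (ha : a ∈ S) (hA : Att H σ χ zs (χ a) E L)
    (hE : ∀ x ∈ E, x ∈ W ∨ x ∈ b :: Y ++ [a]) : False := by
  obtain ⟨x, hx, hxS⟩ := hS.exists_root_not_mem hσ hA
  have hxc := (hA.sub x hx).2
  apply hxS
  -- `J` carries `S` from `a` to `σ b`, the second vertex of `b :: Y ++ [a]`; from there it takes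
  -- the vertices of colour `χ a` on this list.
  have hb := hS.forward_pth pJ hJ ha
  rcases hE x hx with hxW | hxC
  · exact hS.mem_of_color pW hW ha hxW hxc
  · unfold Pth at hC
    generalize hl : b :: Y ++ [a] = l at *
    cases pC with
    | nil => simp at hl
    | @cons y m pm =>
      obtain rfl : b = y := by simpa using (List.cons.inj hl).1
      rw [List.isChain_cons_cons] at hC
      have hcol : χ (σ b) = χ a := by
        have h1 := hC.1.2
        revert h1 hab
        cases χ a <;> cases χ b <;> cases χ (σ b) <;> simp
      simp only [List.mem_cons] at hxC
      rcases hxC with rfl | rfl | hxC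
      · exact absurd hxc.symm hab
      · exact hb
      · exact hS.mem_of_color pm hC.2 hb hxC (hxc.trans hcol.symm)

/-- Delete the frame edge between `a :: W₁` and `W₂ ++ [b]`, and rematch the frame so that `W₁`,
`W₂` and `C = b :: Y ++ [a]` are each paired. A tight set meeting `C` contains `a` or `b`. Using `J`
it then spreads to all roots of the attachment of that colour, contradicting
`IsTight.exists_root_not_mem`. So no tight set meets `C`, which contains `v` and its new partner,
and `v` stays good. -/
theorem Frame.cut (hF : Frame H σ χ zs v) (hσ : IsPairing H σ) (hmin : ∀ H' < H, ¬ Good H' v)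
    (hlen : 4 ≤ zs.length) {W₁ W₂ Y J E E' L L' : List V}
    (hz : (a :: (W₁ ++ W₂) ++ b :: Y).Perm zs) (hW : Pth (CAdj H χ) a (W₁ ++ W₂) b)
    (hY : Pth (CAdj H χ) b Y a) (hab : χ a ≠ χ b) (eW₁ : Even W₁.length) (hv : v ∉ W₁ ++ W₂)
    (hJ : Outer σ zs J) (hJne : J ≠ []) (hJp : Pth H.Adj b J a)
    (hA : Att H σ χ zs (χ a) E L) (hE : ∀ x ∈ E, x ∉ W₂)
    (hA' : Att H σ χ zs (χ b) E' L') (hE' : ∀ x ∈ E', x ∉ W₁) : False := by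
  have eW : Even (W₁ ++ W₂).length := even_length_of_ne hW hab
  have eY := even_length_of_ne hY hab.symm
  have eW₂ : Even W₂.length := by
    rw [List.length_append, Nat.even_add] at eW
    exact eW.1 eW₁
  obtain ⟨P', p, hp⟩ : ∃ P' p, a :: W₁ = P' ++ [p] := by
    rcases List.eq_nil_or_concat (a :: W₁) with h | ⟨P', p, h⟩
    · simp at h
    · exact ⟨P', p, by simpa using h⟩
  obtain ⟨q, Q', hq⟩ : ∃ q Q', W₂ ++ [b] = q :: Q' := List.exists_cons_of_ne_nil (by simp)
  have hpm : p ∈ a :: W₁ := by simp [hp]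
  have hqm : q ∈ W₂ ++ [b] := by simp [hq]
  have hn : ((a :: W₁) ++ ((W₂ ++ [b]) ++ Y)).Nodup := by
    have := hz.nodup_iff.2 hF.nodup
    simpa using this
  rw [List.nodup_append', List.nodup_append'] at hn
  obtain ⟨n1, ⟨n2, -, d2⟩, d1⟩ := hn
  have hch : (P' ++ [p] ++ (q :: Q')).IsChain (CAdj H χ) := by
    rw [← hp, ← hq]
    unfold Pth at hW
    simpa using hW
  have c1 : (a :: W₁).IsChain (CAdj H χ) := hp ▸ hch.left_of_append
  have c2 : (q :: Q').IsChain (CAdj H χ) := hch.right_of_append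
  have hpq : CAdj H χ p q := (List.isChain_append.1 hch).2.2 p (by simp) q (by simp)
  have hmem : ∀ x, x ∈ zs ↔ x ∈ a :: W₁ ∨ x ∈ W₂ ++ [b] ∨ x ∈ Y := by
    intro x
    rw [← hz.mem_iff]
    simp only [List.mem_append, List.mem_cons, List.not_mem_nil, or_false]
    tauto
  have hpz : p ∈ zs := (hmem p).2 (.inl hpm)
  have hqz : q ∈ zs := (hmem q).2 (.inr (.inl hqm))
  have hqW₁ : q ∉ a :: W₁ := fun h => d1 h (List.mem_append_left _ hqm)
  have hpW₂ : p ∉ W₂ ++ [b] := fun h => d1 hpm (List.mem_append_left _ h)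
  have hpY : p ∉ Y := fun h => d1 hpm (List.mem_append_right _ h)
  have hqY : q ∉ Y := fun h => d2 hqm h
  set H' := H.deleteEdges {s(p, q)} with hH'
  have hlt : H' < H := by
    refine lt_of_le_of_ne (SimpleGraph.deleteEdges_le _) fun h => ?_
    have := hpq.1
    rw [← h, hH', SimpleGraph.deleteEdges_adj] at this
    exact this.2 rfl
  have hadj : ∀ x y, H.Adj x y → ¬ (x = p ∧ y = q) → ¬ (x = q ∧ y = p) → H'.Adj x y := by
    intro x y h h1 h2
    rw [hH', SimpleGraph.deleteEdges_adj]
    refine ⟨h, ?_⟩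
    simp only [Set.mem_singleton_iff, Sym2.eq_iff]
    tauto
  have hoff : ∀ x y, H.Adj x y → (x ∉ zs ∨ y ∉ zs) → H'.Adj x y := by
    intro x y h hxy
    refine hadj x y h ?_ ?_
    · rintro ⟨rfl, rfl⟩; exact hxy.elim (· hpz) (· hqz)
    · rintro ⟨rfl, rfl⟩; exact hxy.elim (· hqz) (· hpz)
  have hχ : ∀ x y, H.Adj x y → χ x = χ y → H'.Adj x y := by
    intro x y h hxy
    refine hadj x y h ?_ ?_
    · rintro ⟨rfl, rfl⟩; exact hpq.2 hxy
    · rintro ⟨rfl, rfl⟩; exact hpq.2 hxy.symm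
  have c1' : (a :: W₁).IsChain (CAdj H' χ) := by
    refine c1.imp_of_mem_imp ?_
    intro x y hx hy h
    refine ⟨hadj x y h.1 ?_ ?_, h.2⟩
    · rintro ⟨rfl, rfl⟩; exact hqW₁ hy
    · rintro ⟨rfl, rfl⟩; exact hqW₁ hx
  have c2' : (W₂ ++ [b]).IsChain (CAdj H' χ) := by
    rw [← hq] at c2
    refine c2.imp_of_mem_imp ?_
    intro x y hx hy h
    refine ⟨hadj x y h.1 ?_ ?_, h.2⟩
    · rintro ⟨rfl, rfl⟩; exact hpW₂ hx
    · rintro ⟨rfl, rfl⟩; exact hpW₂ hy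
  have c3' : Pth (CAdj H' χ) b Y a := by
    refine pth_transfer (D := [p, q]) ?_ hY ?_ ?_
    · intro x y h hxy
      simp only [List.mem_cons, List.not_mem_nil, or_false] at hxy
      rw [not_or, not_or] at hxy
      exact ⟨hadj x y h.1 (fun h' => hxy.elim (·.1 h'.1) (·.2 h'.2))
        (fun h' => hxy.elim (·.2 h'.1) (·.1 h'.2)), h.2⟩
    · intro z hz
      simp only [List.mem_cons, List.not_mem_nil, or_false, not_or]
      exact ⟨fun h => hpY (h ▸ hz), fun h => hqY (h ▸ hz)⟩
    · rintro rfl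
      have hba := pth_nil.1 hY
      refine ⟨hadj b a hba.1 ?_ ?_, hba.2⟩
      · rintro ⟨rfl, rfl⟩
        exact hpW₂ (by simp)
      -- The closing edge `b a` could be the deleted one only on a frame with two vertices, which
      -- `hlen` excludes.
      · rintro ⟨rfl, rfl⟩
        have l1 : W₁ = [] := by
          rcases List.eq_nil_or_concat W₁ with h | ⟨W, w, rfl⟩
          · exact h
          · have : w = a := by
              have := congrArg List.getLast? hp
              simpa [List.getLast?_cons] using this
            simp [this] at n1
        have l2 : W₂ = [] := by
          cases W₂ with
          | nil => rfl
          | cons w W =>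
            have : w = b := (List.cons.inj hq).1
            simp [this] at n2
        have := hz.length_eq
        simp [l1, l2] at this
        omega
  have hperm : (W₁ ++ (W₂ ++ (b :: Y ++ [a]))).Perm zs := by
    refine List.Perm.trans ?_ hz
    classical
    rw [List.perm_iff_count]
    intro z
    simp only [List.count_append, List.count_cons, List.count_nil]
    omega
  obtain ⟨τ, hτ, hpair, hτσ⟩ := exists_repair (H := H') (σ := σ) hσ.1
    (l := W₁ ++ (W₂ ++ (b :: Y ++ [a])))
    (fun x hx => hperm.mem_iff.2 (hF.inv x (hperm.mem_iff.1 hx)))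
    (fun x hx => hoff _ _ (hσ.2 x) (.inl fun h => hx (hperm.mem_iff.2 h)))
    ((PairAdj.of_chain ((List.isChain_cons.1 c1').2.imp fun _ _ h => h.1) eW₁).append
      ((PairAdj.of_chain (c2'.left_of_append.imp fun _ _ h => h.1) eW₂).append
        (.of_chain c3'.adj (by simpa [parity_simps] using eY))))
    (hperm.nodup_iff.2 hF.nodup)
  obtain ⟨pW₁, hpair⟩ := hpair.of_append eW₁
  obtain ⟨pW₂, pC⟩ := hpair.of_append eW₂
  have hτz : ∀ x, x ∉ zs → τ x = σ x := fun x hx => hτσ x fun h => hx (hperm.mem_iff.1 h)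
  have pJ : Paired τ J := hJ.paired.congr fun x hx => hτz x (hJ.disj x hx)
  have hJp' : Pth H'.Adj b J a := pth_transfer hoff hJp hJ.disj fun h => absurd h hJne
  have hB := hA.transfer hoff hχ hτz
  have hB' := hA'.transfer hoff hχ hτz
  refine hmin H' hlt ⟨τ, hτ, fun S hS => ?_⟩
  have hC : ∀ x ∈ b :: Y ++ [a], x ∉ S := by
    intro x hx hxS
    rcases hS.end_mem hτ pC c3'.adj rfl (by rw [List.getLast?_append]; rfl) hx hxS with hb | ha
    · refine hS.false_of_spread hτ (W := W₂.reverse) (Y := Y.reverse) (J := J) ?_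
        (pW₂.reverse hτ.1) c3'.crev ?_ pJ hJp' hab.symm hb hB' ?_
      · simpa using isChain_reverse_of_symm (fun _ _ => CAdj.symm) c2'
      · simpa using pC.reverse hτ.1
      · intro x hx
        rcases (hmem x).1 (hA'.sub x hx).1 with h | h | h
        · rcases List.mem_cons.1 h with rfl | h
          · simp
          · exact absurd h (hE' x hx)
        · rcases List.mem_append.1 h with h | h
          · exact .inl (List.mem_reverse.2 h)
          · right; simp [List.mem_singleton.1 h]
        · right; simp [h]
    · refine hS.false_of_spread hτ (W := W₁) (Y := Y) (J := J.reverse) c1' pW₁ c3' pC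
        (pJ.reverse hτ.1) hJp'.arev hab ha hB ?_
      intro x hx
      rcases (hmem x).1 (hA.sub x hx).1 with h | h | h
      · rcases List.mem_cons.1 h with rfl | h
        · simp
        · exact .inl h
      · rcases List.mem_append.1 h with h | h
        · exact absurd h (hE x hx)
        · right; simp [List.mem_singleton.1 h]
      · right; simp [h]
  have hvC : v ∈ b :: Y ++ [a] := by
    rcases (hmem v).1 hF.mem with h | h | h
    · rcases List.mem_cons.1 h with rfl | h
      · simp
      · exact absurd (List.mem_append_left _ h) hv
    · rcases List.mem_append.1 h with h | h
      · exact absurd (List.mem_append_right _ h) hv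
      · simp [List.mem_singleton.1 h]
    · simp [h]
  exact ⟨hC v hvC, hC _ (pC.mem hτ.1 hvC)⟩

end SterboulDeming

/-! ### Minimal good graphs -/

namespace SterboulDeming

variable {V : Type*} {H : SimpleGraph V} {σ : V → V} {χ : V → Bool} {zs : List V} {v : V}
variable {c : Bool} {a b : V}

theorem Att.eq_or_eq {E L : List V} (h : Att H σ χ zs c E L) {x : V} (ha : a ∈ E) (hx : x ∈ E)
    (hax : a ≠ x) : ∀ e ∈ E, e = a ∨ e = x := by
  cases h with
  | ear h =>
    simp only [List.mem_cons, List.not_mem_nil, or_false] at *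
    rintro e (rfl | rfl)
    · rcases ha with rfl | rfl
      · exact .inl rfl
      · exact .inr (hx.resolve_right hax.symm).symm
    · rcases ha with rfl | rfl
      · exact .inr (hx.resolve_left hax.symm).symm
      · exact .inl rfl
  | lollipop h =>
    rw [List.mem_singleton] at ha hx
    exact absurd (ha.trans hx.symm) hax

/-- In a minimal good graph, attachments of both colours to a proper even cycle give a posy. -/
theorem Frame.hasPosy_of_minimal (hF : Frame H σ χ zs v) (hσ : IsPairing H σ)
    (hmin : ∀ H' < H, ¬ Good H' v) (hlen : 4 ≤ zs.length) {d : Bool} (hcd : c ≠ d)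
    {E E' L L' : List V} (hA : Att H σ χ zs c E L) (hA' : Att H σ χ zs d E' L') : HasPosy H v := by
  by_cases hd : ∃ x ∈ L', x ∈ L
  swap
  · push Not at hd
    exact hF.hasPosy_of_disjoint hσ hcd hA hA' hd
  have hlink : ∀ b ∈ E', HasPosy H v ∨ ∃ a ∈ E, ∃ J, J ≠ [] ∧ Outer σ zs J ∧ Pth H.Adj b J a := by
    intro b hb
    obtain ⟨L'', hperm, hp, hch⟩ := hA'.exists_chain hσ.1 hb
    obtain ⟨hbz, hbd⟩ := hA'.sub b hb
    obtain ⟨x, hx, hx'⟩ := hd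
    exact hF.exists_link hσ hA hbz (hbd ▸ hcd.symm) ⟨hp, hperm.nodup_iff.2 hA'.nodup,
      fun x hx => hA'.disj x (hperm.mem_iff.1 hx)⟩ hch ⟨x, hperm.mem_iff.2 hx, hx'⟩
  have hcut : ∀ a ∈ E, ∀ b ∈ E', ∀ J W₁ W₂ Y, J ≠ [] → Outer σ zs J → Pth H.Adj b J a →
      (a :: (W₁ ++ W₂) ++ b :: Y).Perm zs → Pth (CAdj H χ) a (W₁ ++ W₂) b →
      Pth (CAdj H χ) b Y a → Even W₁.length → v ∉ W₁ ++ W₂ → (∀ x ∈ E, x ∉ W₂) →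
      (∀ x ∈ E', x ∉ W₁) → False := by
    intro a ha b hb J W₁ W₂ Y hJne hJ hJp hz hW hY he hv hE hE'
    obtain ⟨-, rfl⟩ := hA.sub a ha
    obtain ⟨-, rfl⟩ := hA'.sub b hb
    exact hF.cut hσ hmin hlen hz hW hY hcd he hv hJ hJne hJp hA hE hA' hE'
  have main : ∀ a ∈ E, ∀ b ∈ E', ∀ J W Y, J ≠ [] → Outer σ zs J → Pth H.Adj b J a →
      (a :: W ++ b :: Y).Perm zs → Pth (CAdj H χ) a W b → Pth (CAdj H χ) b Y a → v ∉ W →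
      HasPosy H v := by
    intro a ha b hb J W Y hJne hJ hJp hz hW hY hv
    have hz' : (b :: Y ++ a :: W).Perm zs := (List.perm_append_comm).trans hz
    -- If no root of the first attachment is inside the arc, its first edge can be deleted.
    by_cases hx : ∃ x ∈ E, x ∈ W
    swap
    · push Not at hx
      exact (hcut a ha b hb J [] W Y hJne hJ hJp hz hW hY (by simp) hv hx (by simp)).elim
    obtain ⟨x, hxE, hxW⟩ := hx
    have hax : a ≠ x := fun h => (not_mem_arc hF.nodup hz' hxW).2.2 h.symm
    have hE := hA.eq_or_eq ha hxE hax
    have hxa : χ a = χ x := (hA.sub a ha).2.trans (hA.sub x hxE).2.symm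
    obtain ⟨Wa, Wb, rfl⟩ := List.append_of_mem hxW
    obtain ⟨h₁, h₂⟩ := pth_append_cons.1 hW
    have hn : (a :: Wa ++ x :: Wb).Nodup := by
      have := hz.nodup_iff.2 hF.nodup
      exact (List.nodup_append'.1 this).1
    have hn' : ∀ w ∈ Wb, w ∉ Wa ∧ w ≠ a ∧ w ≠ x := fun w hw => not_mem_arc hn (.refl _) hw
    -- If no root of the second attachment precedes `x`, the edge just after `x` can be deleted; `Wa
    -- ++ [x]` is even since `a` and `x` have the same colour.
    by_cases hy : ∃ y ∈ E', y ∈ Wa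
    swap
    · push Not at hy
      refine (hcut a ha b hb J (Wa ++ [x]) Wb Y hJne hJ hJp (by simpa using hz)
        (by simpa using hW) hY ?_ (by simpa using hv) ?_ ?_).elim
      · have := odd_length_of_eq h₁ hxa
        simpa [Nat.even_add_one] using this
      · intro e he hew
        rcases hE e he with rfl | rfl
        · exact (hn' _ hew).2.1 rfl
        · exact (hn' _ hew).2.2 rfl
      · intro e he hew
        rcases List.mem_append.1 hew with h | h
        · exact hy e he h
        · obtain rfl := List.mem_singleton.1 h
          exact hcd ((hA.sub e hxE).2.symm.trans (hA'.sub e he).2)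
    obtain ⟨y, hyE, hyW⟩ := hy
    obtain ⟨C₁, C₂, rfl⟩ := List.append_of_mem hyW
    obtain ⟨h₃, h₄⟩ := pth_append_cons.1 h₁
    have hn₂ : ∀ w, w ∈ C₁ ∨ w ∈ C₂ → w ≠ a ∧ w ≠ x := by
      intro w hw
      have hw' : w ∈ C₁ ++ y :: C₂ := by
        simp only [List.mem_append, List.mem_cons]; tauto
      constructor
      · rintro rfl
        rw [List.cons_append] at hn
        exact (List.nodup_cons.1 hn).1 (List.mem_append_left _ hw')
      · rintro rfl
        exact (List.nodup_append'.1 hn).2.2 (List.mem_cons_of_mem _ hw') (by simp)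
    simp only [List.append_assoc, List.cons_append, List.mem_append, List.mem_cons, not_or] at hv
    -- Otherwise link again from `y`. The link ends at `a` or `x`, and the part of the arc between
    -- that root and `y` has no root of the first attachment inside, so its first edge can be
    -- deleted.
    rcases hlink y hyE with h | ⟨e, he, K, hKne, hK, hKp⟩
    · exact h
    refine (?_ : False).elim
    rcases hE e he with rfl | rfl
    · refine hcut e he y hyE K [] C₁ (C₂ ++ x :: Wb ++ b :: Y) hKne hK hKp (by simpa using hz)
        h₃ ?_ (by simp) hv.1 ?_ (by simp)
      · simp only [List.append_assoc, List.cons_append]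
        exact pth_append_cons.2 ⟨h₄, pth_append_cons.2 ⟨h₂, hY⟩⟩
      · intro f hf hfC
        have := hn₂ f (.inl hfC)
        exact (hE f hf).elim this.1 this.2
    · refine hcut e he y hyE K [] C₂.reverse (C₁.reverse ++ a :: Y.reverse ++ b :: Wb.reverse)
        hKne hK hKp ?_ h₄.crev ?_ (by simp) (by simpa using hv.2.2.1) ?_ (by simp)
      · refine List.Perm.trans ?_ hz
        classical
        rw [List.perm_iff_count]
        intro z
        simp only [List.count_append, List.count_cons, List.count_reverse, List.count_nil]
        omega
      · simp only [List.append_assoc, List.cons_append]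
        exact pth_append_cons.2 ⟨h₃.crev, pth_append_cons.2 ⟨hY.crev, h₂.crev⟩⟩
      · intro f hf hfC
        have := hn₂ f (.inr (List.mem_reverse.1 hfC))
        exact (hE f hf).elim this.1 this.2
  obtain ⟨b, hb⟩ : ∃ b, b ∈ E' := by cases hA' <;> exact ⟨_, List.mem_cons_self⟩
  rcases hlink b hb with h | ⟨a, ha, J, hJne, hJ, hJp⟩
  · exact h
  have hab : a ≠ b := by
    rintro rfl
    exact hcd ((hA.sub a ha).2.symm.trans (hA'.sub a hb).2)
  obtain ⟨X, Y, hz, hX, hY⟩ := hF.arcs (hA.sub a ha).1 (hA'.sub b hb).1 hab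
  by_cases hv : v ∈ X
  · refine main a ha b hb J Y.reverse X.reverse hJne hJ hJp (perm_reverse_arcs hz) hY.crev hX.crev
      fun h => ?_
    exact (not_mem_arc hF.nodup hz (List.mem_reverse.1 h)).1 hv
  · exact main a ha b hb J X Y hJne hJ hJp hz hX hY hv

/-- Every simple list can be coloured alternately. -/
theorem exists_coloring {l : List V} (h : l.Nodup) :
    ∃ χ : V → Bool, l.IsChain fun x y => χ x ≠ χ y := by
  classical
  induction l with
  | nil => exact ⟨fun _ => true, .nil⟩
  | cons x l ih =>
    obtain ⟨χ, hχ⟩ := ih (List.nodup_cons.1 h).2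
    cases l with
    | nil => exact ⟨χ, by simp⟩
    | cons y l =>
      refine ⟨Function.update χ x (!χ y), ?_⟩
      have hx := (List.nodup_cons.1 h).1
      rw [List.isChain_cons_cons]
      constructor
      · have : y ≠ x := fun h => hx (by simp [h])
        simp [this]
      · refine hχ.imp_of_mem_imp fun z w hz hw hzw => ?_
        have h1 : z ≠ x := fun h => hx (h ▸ hz)
        have h2 : w ≠ x := fun h => hx (h ▸ hw)
        simpa [h1, h2] using hzw

/-- A simple closed alternating walk is a frame. -/
theorem exists_frame (hσ : IsPairing H σ) {x : V} {t : List V} (hp : Pth H.Adj x t x)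
    (hpair : Paired σ (x :: t)) (hn : (x :: t).Nodup) (hv : v ∈ x :: t) :
    ∃ χ, Frame H σ χ (x :: t) v := by
  obtain ⟨χ, hχ⟩ := exists_coloring hn
  refine ⟨χ, hn, fun a ha => ?_, fun z hz => hpair.mem hσ.1 hz, fun z hz => ?_, hv⟩
  · refine exists_pth_of_mem (R := CAdj H χ) ?_ ha
    have hchain : (x :: t).IsChain (CAdj H χ) := by
      have h1 : (x :: t).IsChain H.Adj := hp.left
      rw [List.isChain_iff_getElem] at h1 hχ ⊢
      exact fun i hi => ⟨h1 i hi, hχ i hi⟩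
    have hev := hpair.even
    rcases List.eq_nil_or_concat t with rfl | ⟨t, y, rfl⟩
    · simp at hev
    · rw [List.concat_eq_append] at *
      have h1 : Pth (CAdj H χ) x t y := hchain
      refine pth_append_cons.2 ⟨h1, pth_nil.2 ⟨pth_nil.1 (pth_append_cons.1 hp).2, ?_⟩⟩
      refine (h1.ceven.1 ?_).symm
      simpa [parity_simps] using hev
  · obtain ⟨l₁, y, l₂, heq, -, -, h⟩ := hpair.split hz
    have : χ y ≠ χ (σ y) := by
      rw [heq] at hχ
      have := hχ.left_of_append.right_of_append
      simpa using this
    rcases h with rfl | rfl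
    · exact this.symm
    · rw [hσ.1]; exact this

/-- The first frame is the edge from `v` to `σ v`. If its attachments meet without giving a posy,
the link closes this edge to an even alternating cycle of length at least four, to which
`Frame.hasPosy_of_minimal` applies. -/
theorem Good.hasPosy_of_minimal [Finite V] (hG : Good H v) (hmin : ∀ H' < H, ¬ Good H' v) :
    HasPosy H v := by
  obtain ⟨σ, hσ, -⟩ := id hG
  obtain ⟨χ, hF⟩ := exists_frame (v := v) hσ (x := v) (t := [σ v])
    (pth_cons.2 ⟨hσ.2 v, pth_nil.2 (hσ.2 v).symm⟩) (.cons v .nil) (by simpa using (hσ.2 v).ne)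
    (by simp)
  obtain ⟨E, L, hA⟩ := hF.exists_att hσ hG (χ v)
  obtain ⟨E', L', hA'⟩ := hF.exists_att hσ hG (χ (σ v))
  have hne : χ v ≠ χ (σ v) := (hF.flip v (by simp)).symm
  by_cases hd : ∃ x ∈ L', x ∈ L
  swap
  · push Not at hd
    exact hF.hasPosy_of_disjoint hσ hne hA hA' hd
  obtain ⟨b, hb⟩ : ∃ b, b ∈ E' := by cases hA' <;> exact ⟨_, List.mem_cons_self⟩
  obtain ⟨hbz, hbd⟩ := hA'.sub b hb
  obtain ⟨L'', hperm, hp, hch⟩ := hA'.exists_chain hσ.1 hb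
  obtain ⟨x, hx, hx'⟩ := hd
  rcases hF.exists_link hσ hA hbz (hbd ▸ hne.symm) ⟨hp, hperm.nodup_iff.2 hA'.nodup,
      fun x hx => hA'.disj x (hperm.mem_iff.1 hx)⟩ hch ⟨x, hperm.mem_iff.2 hx, hx'⟩ with
    h | ⟨a, ha, J, hJne, hJ, hJp⟩
  · exact h
  obtain ⟨haz, had⟩ := hA.sub a ha
  -- On a single-edge frame the colour determines the root.
  obtain rfl : b = σ v := by
    simp only [List.mem_cons, List.not_mem_nil, or_false] at hbz
    rcases hbz with rfl | rfl
    · exact absurd hbd hne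
    · rfl
  obtain rfl : a = v := by
    simp only [List.mem_cons, List.not_mem_nil, or_false] at haz
    rcases haz with rfl | rfl
    · rfl
    · exact absurd had.symm hne
  obtain ⟨χ', hF'⟩ := exists_frame (v := a) hσ (x := a) (t := σ a :: J)
    (pth_cons.2 ⟨hσ.2 a, hJp⟩) (.cons a hJ.paired) (by
      have h1 : a ∉ J := fun h => hJ.disj a h (by simp)
      have h2 : σ a ∉ J := fun h => hJ.disj _ h (by simp)
      simp [h1, h2, hJ.nodup, (hσ.2 a).ne]) (by simp)
  obtain ⟨E₁, L₁, hA₁⟩ := hF'.exists_att hσ hG true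
  obtain ⟨E₂, L₂, hA₂⟩ := hF'.exists_att hσ hG false
  refine hF'.hasPosy_of_minimal hσ hmin ?_ (by simp) hA₁ hA₂
  have := hJ.paired.even
  cases J with
  | nil => exact absurd rfl hJne
  | cons x J =>
    cases J with
    | nil => simp at this
    | cons y J => simp

theorem Good.hasPosy [Finite V] (hG : Good H v) : HasPosy H v := by
  induction H using WellFoundedLT.induction with
  | _ H ih =>
    by_cases hmin : ∃ H' < H, Good H' v
    · obtain ⟨H', hlt, hG'⟩ := hmin
      exact (ih H' hlt hG').mono hlt.le
    · push Not at hmin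
      exact hG.hasPosy_of_minimal hmin

end SterboulDeming

/-! ### The characterization -/

theorem mainTheorem2 {V : Type*} [Finite V] (G : SimpleGraph V) :
    (SterboulDeming.IsSterboulDemingGraph G ∧ ∃ M : G.Subgraph, M.IsPerfectMatching) ↔
      (∀ S : Set V, S.Nonempty → G.IsIndepSet S →
        S.ncard < (SterboulDeming.neighbors G S).ncard) ∧
      (∀ S : Set V, SterboulDeming.numOddComponents G S ≤ S.ncard) := by
  have htutte : (∃ M : G.Subgraph, M.IsPerfectMatching) ↔
      ∀ S : Set V, SterboulDeming.numOddComponents G S ≤ S.ncard := by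
    rw [SimpleGraph.tutte]
    exact forall_congr' fun S => not_lt
  rw [htutte]
  refine and_congr_left fun hodd => ?_
  obtain ⟨M, hM⟩ := htutte.2 hodd
  unfold SterboulDeming.IsSterboulDemingGraph SterboulDeming.KE
  rw [Set.compl_empty_iff, Set.eq_univ_iff_forall]
  constructor
  · rintro hSD S ⟨v, hv⟩ hS
    exact SterboulDeming.ncard_lt_ncard_neighbors hM hS hv (hSD v)
  · intro hS v
    obtain ⟨σ, hσ, -⟩ := SterboulDeming.exists_isPairing hM
    -- Expansion of independent sets leaves only the empty tight set, so every vertex is good.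
    refine (SterboulDeming.Good.hasPosy ⟨σ, hσ, fun S hT => ?_⟩).mem_SD
    obtain rfl : S = ∅ := by
      by_contra hne
      obtain ⟨hi, hc⟩ := (SterboulDeming.isTight_iff hσ).1 hT
      have := hS S (Set.nonempty_iff_ne_empty.2 hne) fun x hx y hy _ => hi x hx y hy
      omega
    simp
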